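/- **Theorem 1.1.** For each $n\ge 1$ let $M_n=(M_n,g_n)$ be a compact connected smooth Riemannian manifold with boundary, of dimension $d_n\ge 2$ (the dimension may depend on $n$), with Riemannian distance $d_{M_n}$ and Riemannian volume $\mathrm{vol}_{M_n}$, and let $f_n:M_n\to\mathbb{R}$ be a smooth function such that $m_{M_n,f_n}:=e^{-f_n}\,\mathrm{vol}_{M_n}$ is a probability measure. Let $\nu_{f_n,1}(M_n)$ be the first (smallest) Dirichlet eigenvalue of the weighted Laplacian $\Delta_{f_n}=\Delta+g_n(\nabla f_n,\nabla\,\cdot\,)$, where $\Delta$ is minus the trace of the Hessian, i.e. of the problem $\Delta_{f_n}\phi=\nu\phi$ in $\mathrm{Int}\,M_n$, $\phi=0$ on $\partial M_n$, understood in the weak sense: $0\neq\phi\in H^1_0(M_n,m_{M_n,f_n})$ and $\int g_n(\nabla\phi,\nabla\psi)\,dm_{M_n,f_n}=\nu\int\phi\psi\,dm_{M_n,f_n}$ for all $\psi\in C_c^\infty(\mathrm{Int}\,M_n)$. If $\nu_{f_n,1}(M_n)\to\infty$ as $n\to\infty$, then $\{(M_n,f_n)\}$ is a boundary concentration family: for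 every $\eta>0$, $$\lim_{n\to\infty}\mathrm{ObsInRad}\bigl((M_n,f_n);-\eta\bigr)=0 .$$ Here, for a connected complete Riemannian manifold $X$ with boundary and a Borel probability measure $\mu$ on $X$, $$\mathrm{ObsInRad}(X;-\eta):=\sup_{\varphi}\ \inf_{\Omega}\ \sup_{t\in\Omega} t ,$$ where $\varphi$ runs over all $1$-Lipschitz functions $\varphi:X\to[0,\infty)$ with $\varphi|_{\partial X}=0$, and $\Omega$ runs over all Borel subsets of $[0,\infty)$ with $\mu(\varphi^{-1}(\Omega))\ge 1-\eta$ (the inner supremum is $0$ for $\Omega=\emptyset$). -/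

import Mathlib

open scoped Manifold ContDiff ENNReal NNReal Topology
open MeasureTheory Filter Bundle

namespace BoundaryConcentration

noncomputable section

section MetricMeasure

variable {X : Type*}

/-- The inscribed radius `sup_{x ∈ Ω} d(x, B)` of a subset `Ω` of a metric space `X` with
boundary `B`; it is `0` for `Ω = ∅`. The value is taken in `[0, ∞]`. -/
def inRad [PseudoEMetricSpace X] (B Ω : Set X) : ℝ≥0∞ :=
  ⨆ x ∈ Ω, Metric.infEDist x B

/-- The `ξ`-partial inscribed radius of `(X, B, μ)`: the infimum of the inscribed radii of the
measurable sets of measure at least `ξ`. -/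
def partInRad [PseudoEMetricSpace X] [MeasurableSpace X] (B : Set X) (μ : Measure X) (ξ : ℝ) :
    ℝ≥0∞ :=
  ⨅ (Ω : Set X) (_ : MeasurableSet Ω) (_ : ENNReal.ofReal ξ ≤ μ Ω), inRad B Ω

/-- The `η`-observable inscribed radius `ObsInRad(X; -η)` of `(X, B, μ)`. The screen is the half
line `[0, ∞)` with its usual distance, its boundary `{0}` and the push-forward measure; `φ` runs
over the `1`-Lipschitz functions to the screen that vanish on the boundary of `X`. -/
def obsInRad [PseudoEMetricSpace X] [MeasurableSpace X] (B : Set X) (μ : Measure X) (η : ℝ) :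
    ℝ≥0∞ :=
  ⨆ (φ : X → ℝ≥0) (_ : LipschitzWith 1 φ) (_ : ∀ x ∈ B, φ x = 0),
    partInRad ({0} : Set ℝ≥0) (μ.map φ) (1 - η)

end MetricMeasure

/-- A sequence of metric measure spaces with boundary `(X n, B n, μ n)` is a boundary concentration
family if `ObsInRad(X n; -η) → 0` for every `η > 0`. -/
def IsBoundaryConcentrationFamily {X : ℕ → Type*} [∀ n, PseudoEMetricSpace (X n)]
    [∀ n, MeasurableSpace (X n)] (B : ∀ n, Set (X n)) (μ : ∀ n, Measure (X n)) : Prop :=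
  ∀ η : ℝ, 0 < η → Tendsto (fun n => obsInRad (B n) (μ n) η) atTop (𝓝 0)

section Riemannian

variable {d : ℕ} [NeZero d] {M : Type*} [TopologicalSpace M]
  [ChartedSpace (EuclideanHalfSpace d) M]
  [RiemannianBundle (fun x : M => TangentSpace (𝓡∂ d) x)]

/-- The `i`-th coordinate vector field `∂_i` of the preferred chart at `x`, at the point with
coordinates `y`. -/
def coordVec (x : M) (y : EuclideanSpace ℝ (Fin d)) (i : Fin d) :
    TangentSpace (𝓡∂ d) ((extChartAt (𝓡∂ d) x).symm y) :=
  mfderivWithin 𝓘(ℝ, EuclideanSpace ℝ (Fin d)) (𝓡∂ d) (extChartAt (𝓡∂ d) x).symm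
    (Set.range (𝓡∂ d)) y (EuclideanSpace.single i (1 : ℝ) : EuclideanSpace ℝ (Fin d))

/-- The matrix `g_{ij} = g(∂_i, ∂_j)` of the metric in the preferred chart at `x`. -/
def gramMatrix (x : M) (y : EuclideanSpace ℝ (Fin d)) : Matrix (Fin d) (Fin d) ℝ :=
  Matrix.of fun i j => inner ℝ (coordVec x y i) (coordVec x y j)

instance tangentSpace_completeSpace (x : M) : CompleteSpace (TangentSpace (𝓡∂ d) x) :=
  haveI : FiniteDimensional ℝ (TangentSpace (𝓡∂ d) x) :=
    inferInstanceAs (FiniteDimensional ℝ (EuclideanSpace ℝ (Fin d)))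
  FiniteDimensional.complete ℝ _

variable (d) in
/-- The gradient of `φ` at `x`: the vector that represents the differential of `φ` with respect to
the Riemannian metric. -/
def grad (φ : M → ℝ) (x : M) : TangentSpace (𝓡∂ d) x :=
  (InnerProductSpace.toDual ℝ (TangentSpace (𝓡∂ d) x)).symm (mfderiv (𝓡∂ d) 𝓘(ℝ, ℝ) φ x)

variable (d) in
/-- The space `C_c^∞(Int M)` of smooth functions with compact support in the interior of `M`. -/
def IsTestFunction (φ : M → ℝ) : Prop :=
  ContMDiff (𝓡∂ d) 𝓘(ℝ, ℝ) ∞ φ ∧ HasCompactSupport φ ∧ tsupport φ ⊆ (𝓡∂ d).interior M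

variable [MeasurableSpace M]

/-- The measure `√(det g_{ij}) dy` of the preferred chart at `x`, carried to `M`. -/
def chartVolume (x : M) : Measure M :=
  ((volume.restrict (extChartAt (𝓡∂ d) x).target).withDensity
    fun y => ENNReal.ofReal (Real.sqrt (gramMatrix x y).det)).map (extChartAt (𝓡∂ d) x).symm

variable (d M) in
/-- The Riemannian volume measure. The measures `√(det g_{ij}) dy` of any two charts coincide on
the common domain, so that the least measure above all of them is the measure that is given by
`√(det g_{ij}) dy` in each chart. -/
def riemannianVolume : Measure M :=
  ⨆ x : M, chartVolume (d := d) x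

variable (d) in
/-- The weighted measure `m_f = e^{-f} vol`. -/
def weightedMeasure (f : M → ℝ) : Measure M :=
  (riemannianVolume d M).withDensity fun x => ENNReal.ofReal (Real.exp (-f x))

variable (d) in
/-- The Dirichlet form `∫ g(∇φ, ∇ψ) dm_f` of two smooth functions. It is the form of the weighted
Laplacian `Δ_f = Δ + g(∇f, ∇ ·)` (with `Δ` minus the trace of the Hessian): integration by parts
with respect to `m_f = e^{-f} vol` gives `∫ (Δ_f φ) ψ dm_f = ∫ g(∇φ, ∇ψ) dm_f` for every test
function `ψ`. -/
def dirichletForm (f φ ψ : M → ℝ) : ℝ :=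
  ∫ x, inner ℝ (grad d φ x) (grad d ψ x) ∂(weightedMeasure d f)

variable (d) in
/-- `u` is a sequence of test functions that converges to `φ` in the Sobolev space
`H¹₀(M, m_f)`, the completion of `C_c^∞(Int M)` in the norm
`(∫ φ² dm_f + ∫ |∇φ|² dm_f)^{1/2}`: it converges to `φ` in `L²(M, m_f)` and its gradients form a
Cauchy sequence in `L²`. -/
structure IsSobolevApproximation (f φ : M → ℝ) (u : ℕ → M → ℝ) : Prop where
  isTestFunction : ∀ j, IsTestFunction d (u j)
  memLp : MemLp φ 2 (weightedMeasure d f)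
  tendsto : Tendsto (fun j => eLpNorm (u j - φ) 2 (weightedMeasure d f)) atTop (𝓝 0)
  cauchy : ∀ ε : ℝ, 0 < ε → ∃ N, ∀ j ≥ N, ∀ k ≥ N, dirichletForm d f (u j - u k) (u j - u k) < ε

variable (d) in
/-- `ν` is a Dirichlet eigenvalue of the weighted Laplacian `Δ_f`: the problem `Δ_f φ = ν φ` in
`Int M`, `φ = 0` on `∂M`, has a weak solution `φ ≠ 0`, i.e. a non-zero `φ ∈ H¹₀(M, m_f)` with
`∫ g(∇φ, ∇ψ) dm_f = ν ∫ φ ψ dm_f` for all test functions `ψ`. The left side for `φ ∈ H¹₀` is the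
limit of its values along an approximating sequence `u`, as `∇φ` is the `L²`-limit of `∇(u j)`. -/
def IsDirichletEigenvalue (f : M → ℝ) (ν : ℝ) : Prop :=
  ∃ (φ : M → ℝ) (u : ℕ → M → ℝ), IsSobolevApproximation d f φ u ∧
    ¬ φ =ᵐ[weightedMeasure d f] 0 ∧
    ∀ ψ : M → ℝ, IsTestFunction d ψ →
      Tendsto (fun j => dirichletForm d f (u j) ψ) atTop
        (𝓝 (ν * ∫ x, φ x * ψ x ∂(weightedMeasure d f)))

variable (d) in
/-- The first (i.e. the smallest) Dirichlet eigenvalue `ν_{f,1}(M)` of the weighted Laplacian. -/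
def firstDirichletEigenvalue (f : M → ℝ) : ℝ :=
  sInf {ν : ℝ | IsDirichletEigenvalue d f ν}

end Riemannian
end
end BoundaryConcentration

open BoundaryConcentration

/-!
Let `φ` be a nonnegative `1`-Lipschitz function that vanishes on `∂M`, and let `s > 0`. The function
`max (φ - s / 4) 0` is supported in the interior of `M`, hence it lies within `s / 4` of a test
function `u` with `|∇u| ≤ 2`. The Poincaré inequality `ν ∫ u² ≤ ∫ |∇u|²`, with the first Dirichlet
eigenvalue `ν` as constant, and Chebyshev's inequality give `m(φ > s) ≤ m(u ≥ s / 2) ≤ 16 / (ν s²)`.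
If `ν` is large, this is at most `η`, so that `Ω = [0, s]` is admissible and the observable inscribed
radius is at most `s`. Two facts carry the argument.

*The Poincaré inequality* (`firstDirichletEigenvalue_mul_integral_sq_le`). The eigenvalues are
defined by weak solutions, so it has to be shown that the infimum of the Rayleigh quotients over test
functions is an eigenvalue. A minimizing sequence has an `L²`-convergent subsequence by Rellich's
theorem (`exists_subseq_cauchy`); the parallelogram identity makes it Cauchy in energy, and its first
variation tends to zero (`isDirichletEigenvalue_of_minimizing`). Rellich's theorem comes from the
Poincaré inequality on the cells of fine grids in charts (`exists_local_functionals`): it bounds the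
`L²` norm by a small multiple of the energy and finitely many integrals. Its transfer to `M` uses
that the weighted measure and the metric are comparable with the Euclidean ones in a small chart
(`exists_chart_comparison`). For the measure, which is defined as a supremum over all charts, this
requires that the chart volumes agree on common domains (`chartVolume_le`).

*The approximation* (`exists_isTestFunction_near`). Near an interior point, mollification in a chart
keeps the Lipschitz constant with respect to the norm of the tangent space at that point, and the
norms of nearby tangent spaces differ by a factor close to `1` (`exists_local_contMDiffOn_near`). The
local approximations are glued by a partition of unity.
-/

namespace BoundaryConcentration

/-! ### The Poincaré inequality on convex sets -/

theorem sq_lintegral_le_mul_lintegral_sq {α : Type*} [MeasurableSpace α] {μ : Measure α}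
    {f : α → ℝ≥0∞} (hf : AEMeasurable f μ) :
    (∫⁻ a, f a ∂μ) ^ 2 ≤ μ Set.univ * ∫⁻ a, f a ^ 2 ∂μ := by
  have h := ENNReal.lintegral_mul_le_Lp_mul_Lq μ Real.HolderConjugate.two_two hf
    (aemeasurable_const (b := (1 : ℝ≥0∞)))
  simp only [Pi.mul_apply, mul_one, lintegral_const, ENNReal.rpow_ofNat, one_pow, one_mul] at h
  calc (∫⁻ a, f a ∂μ) ^ 2
      ≤ ((∫⁻ a, f a ^ 2 ∂μ) ^ (1 / 2 : ℝ) * μ Set.univ ^ (1 / 2 : ℝ)) ^ 2 := by gcongr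
    _ = μ Set.univ * ∫⁻ a, f a ^ 2 ∂μ := by
      rw [mul_pow, ← ENNReal.rpow_mul_natCast, ← ENNReal.rpow_mul_natCast]
      norm_num [mul_comm]

section Convex

variable {E : Type*} [NormedAddCommGroup E] [NormedSpace ℝ E] [FiniteDimensional ℝ E]
  [MeasurableSpace E] [BorelSpace E] (μ : Measure E) [μ.IsAddHaarMeasure]

open Module in
theorem lintegral_comp_add_smul_le {F : E → ℝ≥0∞} (hF : Measurable F) (a : E) {c : ℝ}
    (hc : 1 / 2 ≤ c) :
    ∫⁻ x, F (a + c • x) ∂μ ≤ 2 ^ finrank ℝ E * ∫⁻ x, F x ∂μ := by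
  have hc0 : 0 < c := by linarith
  have h1 : ∫⁻ x, F (a + c • x) ∂μ = ∫⁻ y, F (a + y) ∂(μ.map (c • ·)) := by
    rw [lintegral_map (by fun_prop) (by fun_prop)]
  rw [h1, Measure.map_addHaar_smul μ hc0.ne', lintegral_smul_measure,
    lintegral_add_left_eq_self F a, smul_eq_mul]
  gcongr
  rw [abs_of_pos (by positivity), ← inv_pow]
  have : c⁻¹ ≤ 2 := by
    rw [inv_le_comm₀ hc0 (by norm_num)]; linarith
  calc ENNReal.ofReal (c⁻¹ ^ finrank ℝ E) ≤ ENNReal.ofReal (2 ^ finrank ℝ E) := by gcongr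
    _ = 2 ^ finrank ℝ E := by
      rw [ENNReal.ofReal_pow (by norm_num)]; norm_num

variable {s : Set E} {v : E → ℝ}

omit [FiniteDimensional ℝ E] in
theorem enorm_sub_sq_le_lintegral_segment (hs : IsOpen s) (hc : Convex ℝ s)
    (hv : ContDiffOn ℝ 1 v s) {x y : E} (hx : x ∈ s) (hy : y ∈ s) :
    ‖v x - v y‖ₑ ^ 2 ≤ ‖x - y‖ₑ ^ 2 *
      ∫⁻ t in Set.Icc (0 : ℝ) 1, s.indicator (fun z => ‖fderiv ℝ v z‖ₑ ^ 2)
        ((1 - t) • x + t • y) := by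
  have hseg : ∀ t ∈ Set.Icc (0 : ℝ) 1, (1 - t) • x + t • y ∈ s := fun t ht =>
    hc hx hy (by linarith [ht.2]) ht.1 (by ring)
  have hdiff : ∀ z ∈ s, HasFDerivAt v (fderiv ℝ v z) z := fun z hz =>
    ((hv.differentiableOn one_ne_zero).differentiableAt (hs.mem_nhds hz)).hasFDerivAt
  have hline : ∀ t : ℝ, HasDerivAt (fun t : ℝ => (1 - t) • x + t • y) (y - x) t := by
    intro t
    have h1 : HasDerivAt (fun t : ℝ => (1 - t) • x) ((-1 : ℝ) • x) t := by
      simpa using ((hasDerivAt_const t (1 : ℝ)).sub (hasDerivAt_id t)).smul_const x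
    have h2 : HasDerivAt (fun t : ℝ => t • y) ((1 : ℝ) • y) t := (hasDerivAt_id t).smul_const y
    have h3 := h1.add h2
    rwa [neg_one_smul, one_smul, neg_add_eq_sub] at h3
  have hC : ContDiffOn ℝ 1 (fun t : ℝ => v ((1 - t) • x + t • y)) (Set.Icc 0 1) :=
    hv.comp (by fun_prop) hseg
  have h0 := enorm_sub_le_lintegral_derivWithin_Icc_of_contDiffOn_Icc hC zero_le_one
  simp only [sub_self, zero_smul, one_smul, zero_add, sub_zero, add_zero] at h0
  have h1 : ‖v x - v y‖ₑ ≤ ∫⁻ t in Set.Icc (0 : ℝ) 1,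
      ‖x - y‖ₑ * s.indicator (fun z => ‖fderiv ℝ v z‖ₑ) ((1 - t) • x + t • y) := by
    rw [← enorm_neg, neg_sub]
    refine h0.trans (setLIntegral_mono' measurableSet_Icc fun t ht => ?_)
    have hd : HasDerivAt (fun t : ℝ => v ((1 - t) • x + t • y))
        (fderiv ℝ v ((1 - t) • x + t • y) (y - x)) t :=
      (hdiff _ (hseg t ht)).comp_hasDerivAt t (hline t)
    rw [hd.hasDerivWithinAt.derivWithin (uniqueDiffOn_Icc zero_lt_one t ht),
      Set.indicator_of_mem (hseg t ht), mul_comm, ← enorm_neg (x - y), neg_sub]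
    exact ContinuousLinearMap.le_opENorm _ _
  have hmeas : Measurable (s.indicator (fun z => ‖fderiv ℝ v z‖ₑ)) :=
    ((measurable_fderiv ℝ v).enorm).indicator hs.measurableSet
  have hmeas' : Measurable fun t : ℝ =>
      s.indicator (fun z => ‖fderiv ℝ v z‖ₑ) ((1 - t) • x + t • y) :=
    hmeas.comp (by fun_prop : Continuous fun t : ℝ => (1 - t) • x + t • y).measurable
  rw [lintegral_const_mul _ hmeas'] at h1
  calc ‖v x - v y‖ₑ ^ 2
      ≤ (‖x - y‖ₑ * ∫⁻ t in Set.Icc (0 : ℝ) 1,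
          s.indicator (fun z => ‖fderiv ℝ v z‖ₑ) ((1 - t) • x + t • y)) ^ 2 := by gcongr
    _ ≤ _ := by
      rw [mul_pow]
      gcongr
      refine (sq_lintegral_le_mul_lintegral_sq hmeas'.aemeasurable).trans (le_of_eq ?_)
      simp only [Measure.restrict_apply MeasurableSet.univ, Set.univ_inter, Real.volume_Icc,
        sub_zero, ENNReal.ofReal_one, one_mul]
      refine lintegral_congr fun t => ?_
      by_cases h : (1 - t) • x + t • y ∈ s <;> simp [h]

open Module in
/-- The double integral form of the Poincaré inequality on a convex set: the pair `(x, y)` is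
joined by a segment, and at each time `t` one of the two end points moves the point of the segment
with speed at least `1 / 2`. -/
theorem lintegral_lintegral_enorm_sub_sq_le (hs : IsOpen s) (hc : Convex ℝ s)
    (hv : ContDiffOn ℝ 1 v s) {D : ℝ≥0∞} (hD : ∀ x ∈ s, ∀ y ∈ s, ‖x - y‖ₑ ≤ D) :
    ∫⁻ x in s, ∫⁻ y in s, ‖v x - v y‖ₑ ^ 2 ∂μ ∂μ ≤
      D ^ 2 * (2 ^ finrank ℝ E * (μ s * ∫⁻ x in s, ‖fderiv ℝ v x‖ₑ ^ 2 ∂μ)) := by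
  set F : E → ℝ≥0∞ := s.indicator (fun z => ‖fderiv ℝ v z‖ₑ ^ 2) with hFdef
  have hF : Measurable F :=
    ((measurable_fderiv ℝ v).enorm.pow_const 2).indicator hs.measurableSet
  have hFs : ∫⁻ x, F x ∂μ = ∫⁻ x in s, ‖fderiv ℝ v x‖ₑ ^ 2 ∂μ :=
    lintegral_indicator hs.measurableSet _
  set I := ∫⁻ x in s, ‖fderiv ℝ v x‖ₑ ^ 2 ∂μ
  have hjoint : Measurable fun p : (E × E) × ℝ => F ((1 - p.2) • p.1.1 + p.2 • p.1.2) :=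
    hF.comp (by fun_prop : Continuous fun p : (E × E) × ℝ =>
      (1 - p.2) • p.1.1 + p.2 • p.1.2).measurable
  have hslice : ∀ t ∈ Set.Icc (0 : ℝ) 1,
      ∫⁻ x in s, ∫⁻ y in s, F ((1 - t) • x + t • y) ∂μ ∂μ ≤ 2 ^ finrank ℝ E * (μ s * I) := by
    intro t ht
    have hconst : ∫⁻ _ in s, 2 ^ finrank ℝ E * I ∂μ = 2 ^ finrank ℝ E * (μ s * I) := by
      rw [setLIntegral_const]; ring
    rcases le_total (1 / 2) t with h | h
    · rw [← hconst]
      refine lintegral_mono fun x => ?_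
      refine (setLIntegral_le_lintegral _ _).trans ?_
      rw [← hFs]
      exact lintegral_comp_add_smul_le μ hF _ h
    · rw [lintegral_lintegral_swap, ← hconst]
      · refine lintegral_mono fun y => ?_
        refine (setLIntegral_le_lintegral _ _).trans ?_
        rw [← hFs]
        simp_rw [add_comm _ (t • y)]
        exact lintegral_comp_add_smul_le μ hF _ (by linarith)
      · exact (hF.comp (by fun_prop : Continuous fun p : E × E =>
          (1 - t) • p.1 + t • p.2).measurable).aemeasurable
  calc ∫⁻ x in s, ∫⁻ y in s, ‖v x - v y‖ₑ ^ 2 ∂μ ∂μ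
      ≤ ∫⁻ x in s, ∫⁻ y in s, D ^ 2 *
          (∫⁻ t in Set.Icc (0 : ℝ) 1, F ((1 - t) • x + t • y)) ∂μ ∂μ := by
        refine setLIntegral_mono' hs.measurableSet fun x hx => ?_
        refine setLIntegral_mono' hs.measurableSet fun y hy => ?_
        refine (enorm_sub_sq_le_lintegral_segment hs hc hv hx hy).trans ?_
        gcongr
        exact hD x hx y hy
    _ = D ^ 2 * ∫⁻ p : E × E, (∫⁻ t in Set.Icc (0 : ℝ) 1, F ((1 - t) • p.1 + t • p.2))
          ∂((μ.restrict s).prod (μ.restrict s)) := by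
        have hm : Measurable fun p : E × E =>
            ∫⁻ t in Set.Icc (0 : ℝ) 1, F ((1 - t) • p.1 + t • p.2) := hjoint.lintegral_prod_right'
        rw [← lintegral_const_mul _ hm, lintegral_prod _ (hm.const_mul _).aemeasurable]
    _ = D ^ 2 * ∫⁻ t in Set.Icc (0 : ℝ) 1, ∫⁻ x in s, ∫⁻ y in s, F ((1 - t) • x + t • y) ∂μ ∂μ := by
        rw [lintegral_lintegral_swap hjoint.aemeasurable]
        congr 1
        refine lintegral_congr fun t => ?_
        rw [lintegral_prod]
        exact (hF.comp (by fun_prop : Continuous fun p : E × E =>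
          (1 - t) • p.1 + t • p.2).measurable).aemeasurable
    _ ≤ D ^ 2 * ∫⁻ t in Set.Icc (0 : ℝ) 1, 2 ^ finrank ℝ E * (μ s * I) := by
        gcongr 1
        exact setLIntegral_mono' measurableSet_Icc hslice
    _ = _ := by simp

open Module in
/-- The Poincaré inequality on a bounded open convex set, for functions of arbitrary mean. -/
theorem lintegral_enorm_sq_le_of_convex (hs : IsOpen s) (hc : Convex ℝ s)
    (hv : ContDiffOn ℝ 1 v s) {D : ℝ≥0∞} (hD : ∀ x ∈ s, ∀ y ∈ s, ‖x - y‖ₑ ≤ D)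
    (hμ : μ s ≠ ⊤) (hint : IntegrableOn v s μ) :
    ∫⁻ x in s, ‖v x‖ₑ ^ 2 ∂μ ≤
      2 * 2 ^ finrank ℝ E * D ^ 2 * ∫⁻ x in s, ‖fderiv ℝ v x‖ₑ ^ 2 ∂μ +
        2 * (μ s)⁻¹ * ‖∫ x in s, v x ∂μ‖ₑ ^ 2 := by
  rcases s.eq_empty_or_nonempty with rfl | hne
  · simp
  have hμ0 : μ s ≠ 0 := (hs.measure_pos μ hne).ne'
  set τ := ∫ x in s, v x ∂μ
  set I := ∫⁻ x in s, ‖fderiv ℝ v x‖ₑ ^ 2 ∂μ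
  have hcont : ContinuousOn v s := hv.continuousOn
  have hpt : ∀ x ∈ s, μ s ^ 2 * ‖v x‖ₑ ^ 2 ≤
      2 * μ s * ∫⁻ y in s, ‖v x - v y‖ₑ ^ 2 ∂μ + 2 * ‖τ‖ₑ ^ 2 := by
    intro x hx
    have hconst : IntegrableOn (fun _ => v x) s μ := integrableOn_const hμ
    have hid : (μ.real s) * v x = ∫ y in s, (v x - v y) ∂μ + τ := by
      rw [integral_sub hconst hint, setIntegral_const, smul_eq_mul]
      simp [τ]
    have h1 : μ s * ‖v x‖ₑ ≤ ∫⁻ y in s, ‖v x - v y‖ₑ ∂μ + ‖τ‖ₑ := by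
      have : μ s * ‖v x‖ₑ = ‖(μ.real s) * v x‖ₑ := by
        rw [enorm_mul, Real.enorm_of_nonneg measureReal_nonneg, ofReal_measureReal hμ]
      rw [this, hid]
      refine (enorm_add_le _ _).trans ?_
      gcongr
      exact enorm_integral_le_lintegral_enorm _
    have hm : AEMeasurable (fun y => ‖v x - v y‖ₑ) (μ.restrict s) :=
      (aemeasurable_const.sub (hcont.aemeasurable hs.measurableSet)).enorm
    calc μ s ^ 2 * ‖v x‖ₑ ^ 2 = (μ s * ‖v x‖ₑ) ^ 2 := by ring
      _ ≤ (∫⁻ y in s, ‖v x - v y‖ₑ ∂μ + ‖τ‖ₑ) ^ 2 := by gcongr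
      _ ≤ 2 * ((∫⁻ y in s, ‖v x - v y‖ₑ ∂μ) ^ 2 + ‖τ‖ₑ ^ 2) := by
        have := ENNReal.rpow_add_le_mul_rpow_add_rpow (∫⁻ y in s, ‖v x - v y‖ₑ ∂μ) ‖τ‖ₑ
          (p := 2) (by norm_num)
        norm_num at this
        exact this
      _ ≤ _ := by
        have := sq_lintegral_le_mul_lintegral_sq hm
        rw [Measure.restrict_apply_univ] at this
        rw [mul_add, mul_assoc]
        gcongr
  have hInt : μ s ^ 2 * ∫⁻ x in s, ‖v x‖ₑ ^ 2 ∂μ ≤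
      2 * μ s * (D ^ 2 * (2 ^ finrank ℝ E * (μ s * I))) + 2 * ‖τ‖ₑ ^ 2 * μ s := by
    rw [← lintegral_const_mul' _ _ (by finiteness)]
    refine (setLIntegral_mono' hs.measurableSet hpt).trans ?_
    rw [lintegral_add_right _ measurable_const, lintegral_const_mul' _ _ (by finiteness),
      setLIntegral_const]
    gcongr
    exact lintegral_lintegral_enorm_sub_sq_le μ hs hc hv hD
  have hcancel : (μ s)⁻¹ * μ s = 1 := ENNReal.inv_mul_cancel hμ0 hμ
  calc ∫⁻ x in s, ‖v x‖ₑ ^ 2 ∂μ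
      = ((μ s)⁻¹ * μ s) ^ 2 * ∫⁻ x in s, ‖v x‖ₑ ^ 2 ∂μ := by rw [hcancel]; simp
    _ = (μ s)⁻¹ ^ 2 * (μ s ^ 2 * ∫⁻ x in s, ‖v x‖ₑ ^ 2 ∂μ) := by ring
    _ ≤ (μ s)⁻¹ ^ 2 * (2 * μ s * (D ^ 2 * (2 ^ finrank ℝ E * (μ s * I))) +
          2 * ‖τ‖ₑ ^ 2 * μ s) := by gcongr
    _ = 2 * 2 ^ finrank ℝ E * D ^ 2 * ((μ s)⁻¹ * μ s) ^ 2 * I +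
          2 * ((μ s)⁻¹ * μ s) * (μ s)⁻¹ * ‖τ‖ₑ ^ 2 := by ring
    _ = _ := by rw [hcancel]; simp

end Convex

/-! ### Riemannian norms in charts -/

section Local

variable {d : ℕ} [NeZero d] {M : Type*} [TopologicalSpace M]
  [ChartedSpace (EuclideanHalfSpace d) M]
  [RiemannianBundle (fun x : M => TangentSpace (𝓡∂ d) x)]

/-- The Riemannian norm at `p` of a vector that is given by its coordinates in the preferred chart
at `p`, which identify `TangentSpace (𝓡∂ d) p` with `ℝ^d`. -/
noncomputable def tangentNorm (p : M) (v : EuclideanSpace ℝ (Fin d)) : ℝ :=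
  @norm (TangentSpace (𝓡∂ d) p) _ v

omit [RiemannianBundle (fun x : M => TangentSpace (𝓡∂ d) x)] in
variable (d) in
/-- The derivative at `z` of the inverse of the preferred chart at `x`. -/
noncomputable def chartDeriv (x : M) (z : EuclideanSpace ℝ (Fin d)) :
    EuclideanSpace ℝ (Fin d) →L[ℝ] EuclideanSpace ℝ (Fin d) :=
  mfderivWithin 𝓘(ℝ, EuclideanSpace ℝ (Fin d)) (𝓡∂ d) (extChartAt (𝓡∂ d) x).symm
    (Set.range (𝓡∂ d)) z

variable [IsManifold (𝓡∂ d) ∞ M]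
    [IsContMDiffRiemannianBundle (𝓡∂ d) ∞ (EuclideanSpace ℝ (Fin d))
      (fun x : M => TangentSpace (𝓡∂ d) x)]

variable (d M) in
theorem isContinuousRiemannianBundle :
    IsContinuousRiemannianBundle (EuclideanSpace ℝ (Fin d))
      (fun x : M => TangentSpace (𝓡∂ d) x) := by
  obtain ⟨g, hg, h⟩ := IsContMDiffRiemannianBundle.exists_contMDiff (IB := 𝓡∂ d) (n := ∞)
    (F := EuclideanSpace ℝ (Fin d)) (E := fun x : M => TangentSpace (𝓡∂ d) x)
  exact ⟨g, hg.continuous, h⟩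

/-- Near the centre of a chart, the Riemannian norms of the tangent spaces, read in the chart, agree
up to a factor arbitrarily close to `1`. -/
theorem eventually_tangentNorm_chartDeriv (x : M) {r : ℝ} (hr : 1 < r) :
    ∀ᶠ z in 𝓝[Set.range (𝓡∂ d)] (extChartAt (𝓡∂ d) x x), ∀ w : EuclideanSpace ℝ (Fin d),
      tangentNorm ((extChartAt (𝓡∂ d) x).symm z) (chartDeriv d x z w) ≤ r * tangentNorm x w ∧
      tangentNorm x w ≤ r * tangentNorm ((extChartAt (𝓡∂ d) x).symm z) (chartDeriv d x z w) := by
  have := isContinuousRiemannianBundle d M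
  have h1 := eventually_norm_symmL_trivializationAt_self_comp_lt (EuclideanSpace ℝ (Fin d))
    (fun x : M => TangentSpace (𝓡∂ d) x) x hr
  have h2 := eventually_norm_symmL_trivializationAt_comp_self_lt (EuclideanSpace ℝ (Fin d))
    (fun x : M => TangentSpace (𝓡∂ d) x) x hr
  have hself : ∀ w : EuclideanSpace ℝ (Fin d), chartDeriv d x (extChartAt (𝓡∂ d) x x) w = w := by
    intro w
    exact congrArg (fun f => f w)
      (mfderivWithin_range_extChartAt_symm (I := 𝓡∂ d) (x := x))
  have hself' : ∀ w : EuclideanSpace ℝ (Fin d),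
      (mfderiv (𝓡∂ d) 𝓘(ℝ, EuclideanSpace ℝ (Fin d)) (extChartAt (𝓡∂ d) x) x :
        EuclideanSpace ℝ (Fin d) →L[ℝ] EuclideanSpace ℝ (Fin d)) w = w := by
    intro w
    exact congrArg (fun f => f w) (mfderiv_extChartAt_self (I := 𝓡∂ d) (x := x))
  have hx : (chartAt (EuclideanHalfSpace d) x).source ∈ 𝓝 x := chart_source_mem_nhds _ x
  have key : ∀ᶠ y in 𝓝 x, ∀ w : EuclideanSpace ℝ (Fin d),
      tangentNorm y (chartDeriv d x (extChartAt (𝓡∂ d) x y) w) ≤ r * tangentNorm x w ∧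
      tangentNorm x w ≤ r * tangentNorm y (chartDeriv d x (extChartAt (𝓡∂ d) x y) w) := by
    filter_upwards [h1, h2, hx] with y h1 h2 hy
    rw [TangentBundle.symmL_trivializationAt (mem_chart_source _ x),
      TangentBundle.continuousLinearMapAt_trivializationAt hy] at h1
    rw [TangentBundle.symmL_trivializationAt hy,
      TangentBundle.continuousLinearMapAt_trivializationAt (mem_chart_source _ x)] at h2
    have hinv : ∀ w : EuclideanSpace ℝ (Fin d),
      (mfderiv (𝓡∂ d) 𝓘(ℝ, EuclideanSpace ℝ (Fin d)) (extChartAt (𝓡∂ d) x) y :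
        EuclideanSpace ℝ (Fin d) →L[ℝ] EuclideanSpace ℝ (Fin d))
        (chartDeriv d x (extChartAt (𝓡∂ d) x y) w) = w := by
      intro w
      exact congrArg (fun f => f w) (mfderiv_extChartAt_comp_mfderivWithin_extChartAt_symm'
        (I := 𝓡∂ d) (x := x) (y := y) (by simpa using hy))
    intro w
    constructor
    · have h := ContinuousLinearMap.le_of_opNorm_le _ h2.le (w : TangentSpace (𝓡∂ d) x)
      have e : chartDeriv d x (extChartAt (𝓡∂ d) x y) w =
        chartDeriv d x (extChartAt (𝓡∂ d) x y)
        ((mfderiv (𝓡∂ d) 𝓘(ℝ, EuclideanSpace ℝ (Fin d)) (extChartAt (𝓡∂ d) x) x :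
        EuclideanSpace ℝ (Fin d) →L[ℝ] EuclideanSpace ℝ (Fin d)) w) := by rw [hself']
      rw [e]
      exact h
    · have h := ContinuousLinearMap.le_of_opNorm_le _ h1.le
        (chartDeriv d x (extChartAt (𝓡∂ d) x y) w : TangentSpace (𝓡∂ d) y)
      have e : w = chartDeriv d x (extChartAt (𝓡∂ d) x x)
        ((mfderiv (𝓡∂ d) 𝓘(ℝ, EuclideanSpace ℝ (Fin d)) (extChartAt (𝓡∂ d) x) y :
        EuclideanSpace ℝ (Fin d) →L[ℝ] EuclideanSpace ℝ (Fin d))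
        (chartDeriv d x (extChartAt (𝓡∂ d) x y) w)) := ((hself _).trans (hinv w)).symm
      exact (congrArg (tangentNorm x) e).trans_le h
  have hcont : Tendsto (extChartAt (𝓡∂ d) x).symm
      (𝓝[Set.range (𝓡∂ d)] (extChartAt (𝓡∂ d) x x)) (𝓝 x) := by
    have := (continuousAt_extChartAt_symm (I := 𝓡∂ d) x)
    rw [ContinuousAt, extChartAt_to_inv] at this
    exact this.mono_left nhdsWithin_le_nhds
  filter_upwards [hcont.eventually key, extChartAt_target_mem_nhdsWithin x] with z hz hzt
  rwa [(extChartAt (𝓡∂ d) x).right_inv hzt] at hz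

end Local

/-! ### Covectors and gradients -/

/-- A function that is asymptotically comparable to `a`, with constants arbitrarily close to `1`, has
the same limit as `a`. -/
theorem tendsto_of_forall_le_mul {ι : Type*} {l : Filter ι} {a b : ι → ℝ} {c : ℝ}
    (ha : Tendsto a l (𝓝 c)) (h : ∀ r : ℝ, 1 < r → ∀ᶠ i in l, b i ≤ r * a i ∧ a i ≤ r * b i) :
    Tendsto b l (𝓝 c) := by
  have key : ∀ x y : ℝ, x < y → ∃ r : ℝ, 1 < r ∧ r * x < y := by
    intro x y hxy
    have h1 : Tendsto (fun r : ℝ => r * x) (𝓝[>] 1) (𝓝 (1 * x)) :=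
      ((continuous_id.mul continuous_const).tendsto 1).mono_left nhdsWithin_le_nhds
    rw [one_mul] at h1
    obtain ⟨r, hr, hr1⟩ := ((h1.eventually_lt_const hxy).and self_mem_nhdsWithin).exists
    exact ⟨r, hr1, hr⟩
  refine tendsto_order.2 ⟨fun y hy => ?_, fun y hy => ?_⟩
  · obtain ⟨r, hr, hry⟩ := key y c hy
    filter_upwards [h r hr, ha.eventually_const_lt hry] with i hi hi'
    exact lt_of_mul_lt_mul_left (hi'.trans_le hi.2) (by linarith)
  · obtain ⟨r, hr, hry⟩ := key c y hy
    filter_upwards [h r hr, (ha.const_mul r).eventually_lt_const hry] with i hi hi'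
    exact hi.1.trans_lt hi'

section Local

variable {d : ℕ} [NeZero d] {M : Type*} [TopologicalSpace M]
  [ChartedSpace (EuclideanHalfSpace d) M]
  [RiemannianBundle (fun x : M => TangentSpace (𝓡∂ d) x)]

/-- The Riemannian inner product at `p`, in the same coordinates as `tangentNorm`. -/
noncomputable def tangentInner (p : M) (v w : EuclideanSpace ℝ (Fin d)) : ℝ :=
  @inner ℝ (TangentSpace (𝓡∂ d) p) _ v w

theorem tangentNorm_nonneg (p : M) (v : EuclideanSpace ℝ (Fin d)) : 0 ≤ tangentNorm p v :=
  norm_nonneg (E := TangentSpace (𝓡∂ d) p) v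

theorem tangentNorm_smul (p : M) (c : ℝ) (v : EuclideanSpace ℝ (Fin d)) :
    tangentNorm p (c • v) = |c| * tangentNorm p v :=
  norm_smul (β := TangentSpace (𝓡∂ d) p) c v

theorem exists_tangentNorm_le (p : M) :
    ∃ C : ℝ, 0 < C ∧ ∀ v : EuclideanSpace ℝ (Fin d), tangentNorm p v ≤ C * ‖v‖ := by
  let Φ : EuclideanSpace ℝ (Fin d) →L[ℝ] TangentSpace (𝓡∂ d) p :=
    (ContinuousLinearMap.id ℝ (EuclideanSpace ℝ (Fin d)))
  refine ⟨‖Φ‖ + 1, by positivity, fun v => ?_⟩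
  refine (Φ.le_opNorm v).trans ?_
  gcongr
  linarith

theorem tangentInner_eq (p : M) (v w : EuclideanSpace ℝ (Fin d)) :
    tangentInner p v w = (tangentNorm p (v + w) ^ 2 - tangentNorm p (v - w) ^ 2) / 4 := by
  have h1 := norm_add_sq_real (F := TangentSpace (𝓡∂ d) p) v w
  have h2 := norm_sub_sq_real (F := TangentSpace (𝓡∂ d) p) v w
  have h1' : tangentNorm p (v + w) ^ 2 = tangentNorm p v ^ 2 + 2 * tangentInner p v w +
    tangentNorm p w ^ 2 := h1
  have h2' : tangentNorm p (v - w) ^ 2 = tangentNorm p v ^ 2 - 2 * tangentInner p v w +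
    tangentNorm p w ^ 2 := h2
  rw [h1', h2']
  ring

theorem gramMatrix_apply (x : M) (z : EuclideanSpace ℝ (Fin d)) (i j : Fin d) :
    gramMatrix x z i j = tangentInner ((extChartAt (𝓡∂ d) x).symm z)
      (chartDeriv d x z (EuclideanSpace.single i 1)) (chartDeriv d x z (EuclideanSpace.single j 1)) :=
  rfl

variable (d) in
/-- The Riemannian norm of the gradient of `φ`. -/
noncomputable def normGrad (φ : M → ℝ) (x : M) : ℝ := ‖grad d φ x‖

theorem normGrad_nonneg (φ : M → ℝ) (x : M) : 0 ≤ normGrad d φ x := norm_nonneg _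

omit [RiemannianBundle (fun x : M => TangentSpace (𝓡∂ d) x)] in
variable (d) in
/-- The differential of `φ` at `p`, in the coordinates of the preferred chart at `p`. -/
noncomputable def differential (φ : M → ℝ) (p : M) : EuclideanSpace ℝ (Fin d) →L[ℝ] ℝ :=
  mfderiv (𝓡∂ d) 𝓘(ℝ, ℝ) φ p

/-- The dual norm at `p` of a covector. -/
noncomputable def cotangentNorm (p : M) (α : EuclideanSpace ℝ (Fin d) →L[ℝ] ℝ) : ℝ :=
  @norm (TangentSpace (𝓡∂ d) p →L[ℝ] ℝ) _ α

theorem normGrad_eq (φ : M → ℝ) (p : M) :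
    normGrad d φ p = cotangentNorm p (differential d φ p) :=
  LinearIsometryEquiv.norm_map _ _

theorem cotangentNorm_nonneg (p : M) (α : EuclideanSpace ℝ (Fin d) →L[ℝ] ℝ) :
    0 ≤ cotangentNorm p α := norm_nonneg (E := TangentSpace (𝓡∂ d) p →L[ℝ] ℝ) α

theorem abs_le_cotangentNorm (p : M) (α : EuclideanSpace ℝ (Fin d) →L[ℝ] ℝ)
    (w : EuclideanSpace ℝ (Fin d)) : |α w| ≤ cotangentNorm p α * tangentNorm p w :=
  ContinuousLinearMap.le_opNorm (E := TangentSpace (𝓡∂ d) p) α w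

theorem cotangentNorm_le (p : M) (α : EuclideanSpace ℝ (Fin d) →L[ℝ] ℝ) {C : ℝ} (hC : 0 ≤ C)
    (h : ∀ w, |α w| ≤ C * tangentNorm p w) : cotangentNorm p α ≤ C :=
  ContinuousLinearMap.opNorm_le_bound (E := TangentSpace (𝓡∂ d) p) α hC h

theorem cotangentNorm_smul_le (p : M) (c : ℝ) (α : EuclideanSpace ℝ (Fin d) →L[ℝ] ℝ) :
    cotangentNorm p (c • α) ≤ |c| * cotangentNorm p α := by
  refine cotangentNorm_le p _ (mul_nonneg (abs_nonneg _) (cotangentNorm_nonneg p α)) fun w => ?_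
  rw [_root_.smul_apply, smul_eq_mul, abs_mul, mul_assoc]
  exact mul_le_mul_of_nonneg_left (abs_le_cotangentNorm p α w) (abs_nonneg _)

theorem cotangentNorm_add_le (p : M) (α β : EuclideanSpace ℝ (Fin d) →L[ℝ] ℝ) :
    cotangentNorm p (α + β) ≤ cotangentNorm p α + cotangentNorm p β :=
  norm_add_le (E := TangentSpace (𝓡∂ d) p →L[ℝ] ℝ) α β

theorem exists_le_tangentNorm (p : M) :
    ∃ C : ℝ, 0 < C ∧ ∀ v : EuclideanSpace ℝ (Fin d), ‖v‖ ≤ C * tangentNorm p v := by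
  let Φ : TangentSpace (𝓡∂ d) p →L[ℝ] EuclideanSpace ℝ (Fin d) :=
    (ContinuousLinearMap.id ℝ (EuclideanSpace ℝ (Fin d)))
  refine ⟨‖Φ‖ + 1, by positivity, fun v => ?_⟩
  refine (Φ.le_opNorm v).trans ?_
  exact mul_le_mul_of_nonneg_right (by linarith) (tangentNorm_nonneg p v)

theorem continuous_cotangentNorm (p : M) :
    Continuous (cotangentNorm p : (EuclideanSpace ℝ (Fin d) →L[ℝ] ℝ) → ℝ) := by
  obtain ⟨C, hC, h⟩ := exists_le_tangentNorm (d := d) p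
  refine (LipschitzWith.of_le_add_mul ⟨C, hC.le⟩ fun α β => ?_).continuous
  have h1 : cotangentNorm p (α - β) ≤ C * dist α β := by
    refine cotangentNorm_le p _ (by positivity) fun w => ?_
    calc |(α - β) w| ≤ ‖α - β‖ * ‖w‖ := (α - β).le_opNorm w
      _ ≤ ‖α - β‖ * (C * tangentNorm p w) := by gcongr; exact h w
      _ = C * dist α β * tangentNorm p w := by rw [dist_eq_norm]; ring
  have h2 := cotangentNorm_add_le p β (α - β)
  rw [add_sub_cancel] at h2
  exact h2.trans (by gcongr; exact h1)

/-- The vector that represents the covector `α` with respect to the Riemannian inner product. -/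
noncomputable def riesz (p : M) (α : EuclideanSpace ℝ (Fin d) →L[ℝ] ℝ) : TangentSpace (𝓡∂ d) p :=
  (InnerProductSpace.toDual ℝ (TangentSpace (𝓡∂ d) p)).symm α

theorem grad_eq_riesz (φ : M → ℝ) (p : M) : grad d φ p = riesz p (differential d φ p) := rfl

theorem riesz_add (p : M) (α β : EuclideanSpace ℝ (Fin d) →L[ℝ] ℝ) :
    riesz p (α + β) = riesz p α + riesz p β :=
  map_add (InnerProductSpace.toDual ℝ (TangentSpace (𝓡∂ d) p)).symm α β

theorem riesz_smul (p : M) (c : ℝ) (α : EuclideanSpace ℝ (Fin d) →L[ℝ] ℝ) :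
    riesz p (c • α) = c • riesz p α :=
  (InnerProductSpace.toDual ℝ (TangentSpace (𝓡∂ d) p)).symm.map_smul c α

omit [RiemannianBundle (fun x : M => TangentSpace (𝓡∂ d) x)] in
theorem differential_add {φ ψ : M → ℝ} {p : M} (hφ : MDifferentiableAt (𝓡∂ d) 𝓘(ℝ, ℝ) φ p)
    (hψ : MDifferentiableAt (𝓡∂ d) 𝓘(ℝ, ℝ) ψ p) :
    differential d (φ + ψ) p = differential d φ p + differential d ψ p :=
  mfderiv_add hφ hψ

omit [RiemannianBundle (fun x : M => TangentSpace (𝓡∂ d) x)] in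
theorem differential_const_smul {φ : M → ℝ} {p : M}
    (hφ : MDifferentiableAt (𝓡∂ d) 𝓘(ℝ, ℝ) φ p) (c : ℝ) :
    differential d (c • φ) p = c • differential d φ p :=
  const_smul_mfderiv hφ c

theorem inner_grad_add_left {φ ψ χ : M → ℝ} {p : M}
    (hφ : MDifferentiableAt (𝓡∂ d) 𝓘(ℝ, ℝ) φ p) (hψ : MDifferentiableAt (𝓡∂ d) 𝓘(ℝ, ℝ) ψ p) :
    inner ℝ (grad d (φ + ψ) p) (grad d χ p) =
      inner ℝ (grad d φ p) (grad d χ p) + inner ℝ (grad d ψ p) (grad d χ p) := by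
  rw [← inner_add_left, grad_eq_riesz (φ + ψ), differential_add hφ hψ, riesz_add]
  rfl

theorem inner_grad_smul_left {φ χ : M → ℝ} {p : M}
    (hφ : MDifferentiableAt (𝓡∂ d) 𝓘(ℝ, ℝ) φ p) (c : ℝ) :
    inner ℝ (grad d (c • φ) p) (grad d χ p) = c * inner ℝ (grad d φ p) (grad d χ p) := by
  rw [← real_inner_smul_left, grad_eq_riesz (c • φ), differential_const_smul hφ, riesz_smul]
  rfl

theorem inner_grad_comm (φ χ : M → ℝ) (p : M) :
    inner ℝ (grad d φ p) (grad d χ p) = inner ℝ (grad d χ p) (grad d φ p) :=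
  real_inner_comm _ _

theorem inner_grad_self (φ : M → ℝ) (p : M) :
    inner ℝ (grad d φ p) (grad d φ p) = normGrad d φ p ^ 2 :=
  real_inner_self_eq_norm_sq _

end Local

/-! ### Functions and the metric in charts -/

section Local

variable {d : ℕ} [NeZero d] {M : Type*} [TopologicalSpace M]
  [ChartedSpace (EuclideanHalfSpace d) M] [IsManifold (𝓡∂ d) ∞ M]

/-- The derivative is taken within the half space, which also covers boundary points. -/
theorem hasFDerivWithinAt_comp_extChartAt_symm {x : M} {z : EuclideanSpace ℝ (Fin d)}
    (hz : z ∈ (extChartAt (𝓡∂ d) x).target) {φ : M → ℝ}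
    (hφ : MDifferentiableAt (𝓡∂ d) 𝓘(ℝ, ℝ) φ ((extChartAt (𝓡∂ d) x).symm z)) :
    HasFDerivWithinAt (φ ∘ (extChartAt (𝓡∂ d) x).symm)
      ((differential d φ ((extChartAt (𝓡∂ d) x).symm z)).comp (chartDeriv d x z))
      (Set.range (𝓡∂ d)) z :=
  (hφ.hasMFDerivAt.comp_hasMFDerivWithinAt z
    (mdifferentiableWithinAt_extChartAt_symm hz).hasMFDerivWithinAt).hasFDerivWithinAt

theorem exists_chartDeriv_eq {x : M} {z : EuclideanSpace ℝ (Fin d)}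
    (hz : z ∈ (extChartAt (𝓡∂ d) x).target) (v : EuclideanSpace ℝ (Fin d)) :
    ∃ w, chartDeriv d x z w = v :=
  ⟨_, congrArg (fun f => f v) (mfderivWithin_extChartAt_symm_comp_mfderiv_extChartAt
    (I := 𝓡∂ d) hz)⟩

theorem chartDeriv_self (x : M) (w : EuclideanSpace ℝ (Fin d)) :
    chartDeriv d x (extChartAt (𝓡∂ d) x x) w = w :=
  congrArg (fun f => f w) (mfderivWithin_range_extChartAt_symm (I := 𝓡∂ d) (x := x))

theorem contDiffOn_comp_extChartAt_symm (x : M) {φ : M → ℝ} {n : ℕ∞ω} (hn : n ≤ (∞ : ℕ∞ω))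
    (hφ : ContMDiff (𝓡∂ d) 𝓘(ℝ, ℝ) n φ) :
    ContDiffOn ℝ n (φ ∘ (extChartAt (𝓡∂ d) x).symm) (extChartAt (𝓡∂ d) x).target := by
  rw [← contMDiffOn_iff_contDiffOn]
  exact hφ.comp_contMDiffOn ((contMDiffOn_extChartAt_symm (n := ∞) x).of_le hn)

variable [RiemannianBundle (fun x : M => TangentSpace (𝓡∂ d) x)]
    [IsContMDiffRiemannianBundle (𝓡∂ d) ∞ (EuclideanSpace ℝ (Fin d))
      (fun x : M => TangentSpace (𝓡∂ d) x)]

theorem continuous_normGrad {φ : M → ℝ} (hφ : ContMDiff (𝓡∂ d) 𝓘(ℝ, ℝ) 1 φ) :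
    Continuous (normGrad d φ) := by
  refine continuous_iff_continuousAt.2 fun x => ?_
  set e := extChartAt (𝓡∂ d) x
  set D : M → EuclideanSpace ℝ (Fin d) →L[ℝ] ℝ :=
    fun y => fderivWithin ℝ (φ ∘ e.symm) e.target (e y) with hDdef
  have hD : ContinuousAt D x := by
    have h1 : ContinuousOn (fderivWithin ℝ (φ ∘ e.symm) e.target) e.target :=
      (contDiffOn_comp_extChartAt_symm x (by simp) hφ).continuousOn_fderivWithin
        (uniqueDiffOn_extChartAt_target x) le_rfl
    exact (h1.comp (continuousOn_extChartAt x) e.mapsTo).continuousAt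
      (extChartAt_source_mem_nhds x)
  have hDeq : ∀ y ∈ e.source, D y = (differential d φ y).comp (chartDeriv d x (e y)) := by
    intro y hy
    have hz : e y ∈ e.target := e.map_source hy
    have h := hasFDerivWithinAt_comp_extChartAt_symm (x := x) hz
      ((hφ.mdifferentiable one_ne_zero) _)
    have h' := (h.mono (extChartAt_target_subset_range x)).fderivWithin
      (uniqueDiffOn_extChartAt_target x _ hz)
    rw [hDdef]
    simp only
    rw [h', e.left_inv hy]
  have hDx : cotangentNorm x (D x) = normGrad d φ x := by
    rw [normGrad_eq, hDeq x (mem_extChartAt_source x)]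
    congr 1
    ext w
    exact congrArg (differential d φ x) (chartDeriv_self x w)
  have hlim : Tendsto (fun y => cotangentNorm x (D y)) (𝓝 x) (𝓝 (normGrad d φ x)) := by
    rw [← hDx]
    exact (continuous_cotangentNorm x).continuousAt.tendsto.comp hD
  refine tendsto_of_forall_le_mul hlim fun r hr => ?_
  have hK : ∀ᶠ y in 𝓝 x, _ := (tendsto_nhdsWithin_iff.2
    ⟨(continuousAt_extChartAt (I := 𝓡∂ d) x).tendsto,
      Eventually.of_forall fun y => by simp [extChartAt]⟩).eventually
    (eventually_tangentNorm_chartDeriv x hr)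
  filter_upwards [hK, extChartAt_source_mem_nhds (I := 𝓡∂ d) x] with y hy hys
  rw [(extChartAt (𝓡∂ d) x).left_inv hys] at hy
  have hr0 : 0 ≤ r := by linarith
  constructor
  · rw [normGrad_eq]
    refine cotangentNorm_le y _ (mul_nonneg hr0 (cotangentNorm_nonneg _ _)) fun v => ?_
    obtain ⟨w, rfl⟩ := exists_chartDeriv_eq (e.map_source hys) v
    calc |differential d φ y (chartDeriv d x (e y) w)| = |D y w| := by rw [hDeq y hys]; rfl
      _ ≤ cotangentNorm x (D y) * tangentNorm x w := abs_le_cotangentNorm _ _ _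
      _ ≤ cotangentNorm x (D y) * (r * tangentNorm y (chartDeriv d x (e y) w)) :=
        mul_le_mul_of_nonneg_left (hy w).2 (cotangentNorm_nonneg _ _)
      _ = _ := by ring
  · refine cotangentNorm_le x _ (mul_nonneg hr0 (normGrad_nonneg _ _)) fun w => ?_
    calc |D y w| = |differential d φ y (chartDeriv d x (e y) w)| := by rw [hDeq y hys]; rfl
      _ ≤ normGrad d φ y * tangentNorm y (chartDeriv d x (e y) w) := by
        rw [normGrad_eq]; exact abs_le_cotangentNorm _ _ _
      _ ≤ normGrad d φ y * (r * tangentNorm x w) :=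
        mul_le_mul_of_nonneg_left (hy w).1 (normGrad_nonneg _ _)
      _ = _ := by ring

theorem continuous_inner_grad {φ ψ : M → ℝ} (hφ : ContMDiff (𝓡∂ d) 𝓘(ℝ, ℝ) 1 φ)
    (hψ : ContMDiff (𝓡∂ d) 𝓘(ℝ, ℝ) 1 ψ) :
    Continuous fun x => inner ℝ (grad d φ x) (grad d ψ x) := by
  have h : (fun x => inner ℝ (grad d φ x) (grad d ψ x)) = fun x =>
      (normGrad d (φ + ψ) x ^ 2 - normGrad d φ x ^ 2 - normGrad d ψ x ^ 2) / 2 := by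
    funext x
    have h1 := (hφ.mdifferentiable one_ne_zero) x
    have h2 := (hψ.mdifferentiable one_ne_zero) x
    rw [← inner_grad_self, ← inner_grad_self, ← inner_grad_self, inner_grad_add_left h1 h2,
      inner_grad_comm φ (φ + ψ), inner_grad_comm ψ (φ + ψ), inner_grad_add_left h1 h2,
      inner_grad_add_left h1 h2, inner_grad_comm ψ φ]
    ring
  rw [h]
  have h1 := continuous_normGrad (hφ.add hψ)
  have h2 := continuous_normGrad hφ
  have h3 := continuous_normGrad hψ
  change Continuous (normGrad d (φ + ψ)) at h1
  fun_prop

theorem tendsto_gramMatrix (x : M) :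
    Tendsto (gramMatrix x) (𝓝[Set.range (𝓡∂ d)] (extChartAt (𝓡∂ d) x x))
      (𝓝 (gramMatrix x (extChartAt (𝓡∂ d) x x))) := by
  have hlim : ∀ w : EuclideanSpace ℝ (Fin d), Tendsto
      (fun z => tangentNorm ((extChartAt (𝓡∂ d) x).symm z) (chartDeriv d x z w))
      (𝓝[Set.range (𝓡∂ d)] (extChartAt (𝓡∂ d) x x)) (𝓝 (tangentNorm x w)) := fun w =>
    tendsto_of_forall_le_mul tendsto_const_nhds fun r hr =>
      (eventually_tangentNorm_chartDeriv x hr).mono fun z hz => hz w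
  refine tendsto_pi_nhds.2 fun i => tendsto_pi_nhds.2 fun j => ?_
  simp only [gramMatrix_apply, tangentInner_eq, ← map_add, ← map_sub]
  rw [extChartAt_to_inv, chartDeriv_self, chartDeriv_self]
  exact (((hlim _).pow 2).sub ((hlim _).pow 2)).div_const 4

omit [IsContMDiffRiemannianBundle (𝓡∂ d) ∞ (EuclideanSpace ℝ (Fin d))
      (fun x : M => TangentSpace (𝓡∂ d) x)] in
theorem det_gramMatrix_self_pos (x : M) :
    0 < (gramMatrix x (extChartAt (𝓡∂ d) x x)).det := by
  have hli : LinearIndependent ℝ fun i : Fin d =>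
      (EuclideanSpace.single i 1 : EuclideanSpace ℝ (Fin d)) := by
    have h := (EuclideanSpace.basisFun (Fin d) ℝ).toBasis.linearIndependent
    rw [OrthonormalBasis.coe_toBasis] at h
    rwa [show ⇑(EuclideanSpace.basisFun (Fin d) ℝ) = fun i : Fin d => EuclideanSpace.single i 1
      from funext fun i => EuclideanSpace.basisFun_apply _ _ i] at h
  have h := (Matrix.posDef_gram_of_linearIndependent (𝕜 := ℝ) (E := TangentSpace (𝓡∂ d) x)
    (v := fun i : Fin d => (EuclideanSpace.single i 1 : EuclideanSpace ℝ (Fin d))) hli).det_pos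
  refine h.trans_eq (congrArg Matrix.det ?_)
  ext i j
  rw [gramMatrix_apply, extChartAt_to_inv, chartDeriv_self, chartDeriv_self]
  rfl

theorem exists_eventually_sqrt_det_gramMatrix (x : M) :
    ∃ C : ℝ, 0 < C ∧ ∀ᶠ z in 𝓝[Set.range (𝓡∂ d)] (extChartAt (𝓡∂ d) x x),
      √(gramMatrix x z).det ≤ C ∧ 1 ≤ C * √(gramMatrix x z).det := by
  set a := √(gramMatrix x (extChartAt (𝓡∂ d) x x)).det
  have ha : 0 < a := Real.sqrt_pos.2 (det_gramMatrix_self_pos x)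
  have hlim : Tendsto (fun z => √(gramMatrix x z).det)
      (𝓝[Set.range (𝓡∂ d)] (extChartAt (𝓡∂ d) x x)) (𝓝 a) :=
    ((Real.continuous_sqrt.comp (continuous_id.matrix_det)).tendsto _).comp (tendsto_gramMatrix x)
  refine ⟨max (2 * a) (2 / a), by positivity, ?_⟩
  filter_upwards [hlim.eventually_lt_const (by linarith : a < 2 * a),
    hlim.eventually_const_lt (by linarith : a / 2 < a)] with z h1 h2
  refine ⟨h1.le.trans (le_max_left _ _), ?_⟩
  calc (1 : ℝ) = 2 / a * (a / 2) := by field_simp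
    _ ≤ _ := by gcongr; exact le_max_right _ _

end Local

/-! ### The Riemannian volume in charts -/

section Transition

variable {d : ℕ} [NeZero d] {M : Type*} [TopologicalSpace M]
  [ChartedSpace (EuclideanHalfSpace d) M] [IsManifold (𝓡∂ d) ∞ M]

variable (d) in
/-- The derivative at `z` of the change of coordinates from the preferred chart at `x` to the
preferred chart at `x₀`. -/
noncomputable def transitionDeriv (x x₀ : M) (z : EuclideanSpace ℝ (Fin d)) :
    EuclideanSpace ℝ (Fin d) →L[ℝ] EuclideanSpace ℝ (Fin d) :=
  (show EuclideanSpace ℝ (Fin d) →L[ℝ] EuclideanSpace ℝ (Fin d) from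
    mfderiv (𝓡∂ d) 𝓘(ℝ, EuclideanSpace ℝ (Fin d)) (extChartAt (𝓡∂ d) x₀)
      ((extChartAt (𝓡∂ d) x).symm z)).comp (chartDeriv d x z)

variable {x x₀ : M} {z : EuclideanSpace ℝ (Fin d)}

theorem hasFDerivWithinAt_transition (hz : z ∈ (extChartAt (𝓡∂ d) x).target)
    (hz₀ : (extChartAt (𝓡∂ d) x).symm z ∈ (extChartAt (𝓡∂ d) x₀).source) :
    HasFDerivWithinAt (extChartAt (𝓡∂ d) x₀ ∘ (extChartAt (𝓡∂ d) x).symm)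
      (transitionDeriv d x x₀ z) (Set.range (𝓡∂ d)) z :=
  ((mdifferentiableAt_extChartAt (by simpa using hz₀)).hasMFDerivAt.comp_hasMFDerivWithinAt z
    (mdifferentiableWithinAt_extChartAt_symm hz).hasMFDerivWithinAt).hasFDerivWithinAt

theorem chartDeriv_transitionDeriv
    (hz₀ : (extChartAt (𝓡∂ d) x).symm z ∈ (extChartAt (𝓡∂ d) x₀).source)
    (w : EuclideanSpace ℝ (Fin d)) :
    chartDeriv d x₀ (extChartAt (𝓡∂ d) x₀ ((extChartAt (𝓡∂ d) x).symm z))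
      (transitionDeriv d x x₀ z w) = chartDeriv d x z w :=
  congrArg (fun f => f (chartDeriv d x z w))
    (mfderivWithin_extChartAt_symm_comp_mfderiv_extChartAt' (I := 𝓡∂ d) hz₀)

variable [RiemannianBundle (fun x : M => TangentSpace (𝓡∂ d) x)]

/-- The Riemannian inner product at `p`, as a bilinear form on the coordinates. -/
noncomputable def tangentBilin (p : M) : LinearMap.BilinForm ℝ (EuclideanSpace ℝ (Fin d)) :=
  innerₗ (TangentSpace (𝓡∂ d) p)

omit [IsManifold (𝓡∂ d) ∞ M] in
theorem gramMatrix_eq_toMatrix (x : M) (z : EuclideanSpace ℝ (Fin d)) :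
    gramMatrix x z = LinearMap.BilinForm.toMatrix (EuclideanSpace.basisFun (Fin d) ℝ).toBasis
      ((tangentBilin ((extChartAt (𝓡∂ d) x).symm z)).comp (chartDeriv d x z).toLinearMap
        (chartDeriv d x z).toLinearMap) := by
  ext i j
  rw [LinearMap.BilinForm.toMatrix_apply, gramMatrix_apply, OrthonormalBasis.coe_toBasis,
    EuclideanSpace.basisFun_apply, EuclideanSpace.basisFun_apply]
  rfl

theorem det_gramMatrix_transition
    (hz₀ : (extChartAt (𝓡∂ d) x).symm z ∈ (extChartAt (𝓡∂ d) x₀).source) :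
    (gramMatrix x z).det = (transitionDeriv d x x₀ z).det ^ 2 *
      (gramMatrix x₀ (extChartAt (𝓡∂ d) x₀ ((extChartAt (𝓡∂ d) x).symm z))).det := by
  set b := (EuclideanSpace.basisFun (Fin d) ℝ).toBasis
  set J := transitionDeriv d x x₀ z
  have h : (tangentBilin ((extChartAt (𝓡∂ d) x).symm z)).comp (chartDeriv d x z).toLinearMap
        (chartDeriv d x z).toLinearMap =
      ((tangentBilin ((extChartAt (𝓡∂ d) x).symm z)).comp
        (chartDeriv d x₀ (extChartAt (𝓡∂ d) x₀ ((extChartAt (𝓡∂ d) x).symm z))).toLinearMap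
        (chartDeriv d x₀ (extChartAt (𝓡∂ d) x₀ ((extChartAt (𝓡∂ d) x).symm z))).toLinearMap).comp
        J.toLinearMap J.toLinearMap := by
    refine LinearMap.ext₂ fun v w => ?_
    simp only [LinearMap.BilinForm.comp_apply, ContinuousLinearMap.coe_coe]
    rw [chartDeriv_transitionDeriv hz₀, chartDeriv_transitionDeriv hz₀]
  rw [gramMatrix_eq_toMatrix, gramMatrix_eq_toMatrix, (extChartAt (𝓡∂ d) x₀).left_inv hz₀, h,
    LinearMap.BilinForm.toMatrix_comp b b, Matrix.det_mul, Matrix.det_mul, Matrix.det_transpose,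
    LinearMap.det_toMatrix]
  rw [ContinuousLinearMap.det]
  ring

theorem sqrt_det_gramMatrix_transition
    (hz₀ : (extChartAt (𝓡∂ d) x).symm z ∈ (extChartAt (𝓡∂ d) x₀).source) :
    √(gramMatrix x z).det = |(transitionDeriv d x x₀ z).det| *
      √(gramMatrix x₀ (extChartAt (𝓡∂ d) x₀ ((extChartAt (𝓡∂ d) x).symm z))).det := by
  rw [det_gramMatrix_transition hz₀, Real.sqrt_mul (sq_nonneg _), Real.sqrt_sq_eq_abs]

end Transition

section Volume

variable {d : ℕ} [NeZero d] {M : Type*} [TopologicalSpace M]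
  [ChartedSpace (EuclideanHalfSpace d) M] [MeasurableSpace M] [BorelSpace M]

omit [MeasurableSpace M] [BorelSpace M] in
theorem measurableSet_extChartAt_target (x : M) :
    MeasurableSet (extChartAt (𝓡∂ d) x).target := by
  rw [extChartAt_target]
  exact (((chartAt _ x).open_target.preimage (𝓡∂ d).continuous_symm).measurableSet).inter
    (𝓡∂ d).isClosed_range.measurableSet

theorem aemeasurable_extChartAt_symm (x : M) {s : Set (EuclideanSpace ℝ (Fin d))}
    (hs : s ⊆ (extChartAt (𝓡∂ d) x).target) :
    AEMeasurable (extChartAt (𝓡∂ d) x).symm (volume.restrict s) :=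
  ((continuousOn_extChartAt_symm x).aemeasurable
    (measurableSet_extChartAt_target x)).mono_measure (Measure.restrict_mono hs le_rfl)

theorem measurableSet_target_inter_preimage (x : M) {A : Set M} (hA : MeasurableSet A) :
    MeasurableSet ((extChartAt (𝓡∂ d) x).target ∩ (extChartAt (𝓡∂ d) x).symm ⁻¹' A) := by
  classical
  have hg : Measurable ((extChartAt (𝓡∂ d) x).target.piecewise (extChartAt (𝓡∂ d) x).symm
      fun _ => x) :=
    ContinuousOn.measurable_piecewise (continuousOn_extChartAt_symm x) continuousOn_const
      (measurableSet_extChartAt_target x)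
  convert (measurableSet_extChartAt_target x).inter (hg hA) using 1
  ext z
  simp only [Set.mem_inter_iff, Set.mem_preimage]
  refine and_congr_right fun hz => ?_
  rw [Set.piecewise_eq_of_mem _ _ _ hz]

variable [RiemannianBundle (fun x : M => TangentSpace (𝓡∂ d) x)]

theorem chartVolume_apply (x : M) {A : Set M} (hA : MeasurableSet A) :
    chartVolume (d := d) x A =
      ∫⁻ z in (extChartAt (𝓡∂ d) x).target ∩ (extChartAt (𝓡∂ d) x).symm ⁻¹' A,
        ENNReal.ofReal √(gramMatrix x z).det := by
  rw [chartVolume, Measure.map_apply_of_aemeasurable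
    ((aemeasurable_extChartAt_symm x subset_rfl).mono_ac (withDensity_absolutelyContinuous _ _)) hA,
    withDensity_apply', Measure.restrict_restrict' (measurableSet_extChartAt_target x),
    Set.inter_comm]

variable [IsManifold (𝓡∂ d) ∞ M]

/-- The chart volumes agree on common domains: the change of variables formula holds on all of the
half space, with derivatives within it, so that boundary points need no separate treatment. -/
theorem chartVolume_le (x x₀ : M) {A : Set M} (hA : MeasurableSet A)
    (hA₀ : A ⊆ (extChartAt (𝓡∂ d) x₀).source) :
    chartVolume (d := d) x A ≤ chartVolume (d := d) x₀ A := by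
  rw [chartVolume_apply x hA, chartVolume_apply x₀ hA]
  set s := (extChartAt (𝓡∂ d) x).target ∩ (extChartAt (𝓡∂ d) x).symm ⁻¹' A
  have hs : MeasurableSet s := measurableSet_target_inter_preimage x hA
  have hsub : s ⊆ Set.range (𝓡∂ d) := fun z hz => extChartAt_target_subset_range x hz.1
  have hinj : Set.InjOn (extChartAt (𝓡∂ d) x₀ ∘ (extChartAt (𝓡∂ d) x).symm) s := by
    intro z hz z' hz' h
    exact (extChartAt (𝓡∂ d) x).symm.injOn hz.1 hz'.1
      ((extChartAt (𝓡∂ d) x₀).injOn (hA₀ hz.2) (hA₀ hz'.2) h)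
  have hder : ∀ z ∈ s, HasFDerivWithinAt (extChartAt (𝓡∂ d) x₀ ∘ (extChartAt (𝓡∂ d) x).symm)
      (transitionDeriv d x x₀ z) s z := fun z hz =>
    (hasFDerivWithinAt_transition hz.1 (hA₀ hz.2)).mono hsub
  calc ∫⁻ z in s, ENNReal.ofReal √(gramMatrix x z).det
      = ∫⁻ z in s, ENNReal.ofReal |(transitionDeriv d x x₀ z).det| * ENNReal.ofReal
          √(gramMatrix x₀ ((extChartAt (𝓡∂ d) x₀ ∘ (extChartAt (𝓡∂ d) x).symm) z)).det := by
        refine setLIntegral_congr_fun hs fun z hz => ?_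
        rw [← ENNReal.ofReal_mul (abs_nonneg _), sqrt_det_gramMatrix_transition (hA₀ hz.2)]
        rfl
    _ = ∫⁻ z in (extChartAt (𝓡∂ d) x₀ ∘ (extChartAt (𝓡∂ d) x).symm) '' s,
          ENNReal.ofReal √(gramMatrix x₀ z).det :=
        (lintegral_image_eq_lintegral_abs_det_fderiv_mul volume hs hder hinj
          fun z => ENNReal.ofReal √(gramMatrix x₀ z).det).symm
    _ ≤ _ := by
        refine lintegral_mono_set ?_
        rintro _ ⟨z, hz, rfl⟩
        have h := hA₀ hz.2
        exact ⟨(extChartAt (𝓡∂ d) x₀).map_source h, by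
          simpa only [Set.mem_preimage, Function.comp_apply, (extChartAt (𝓡∂ d) x₀).left_inv h]
            using hz.2⟩

/-- The supremum that defines the volume does not exceed any single chart volume on the domain of
that chart. -/
theorem riemannianVolume_apply_le (x₀ : M) {A : Set M} (hA : MeasurableSet A)
    (hA₀ : A ⊆ (extChartAt (𝓡∂ d) x₀).source) :
    riemannianVolume d M A ≤ chartVolume (d := d) x₀ A := by
  set U := (extChartAt (𝓡∂ d) x₀).source
  have hU : MeasurableSet U := (isOpen_extChartAt_source x₀).measurableSet
  have h : riemannianVolume d M ≤
      (chartVolume (d := d) x₀).restrict U + (⊤ : Measure M).restrict Uᶜ := by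
    refine iSup_le fun x => Measure.le_iff.2 fun s hs => ?_
    rw [Measure.add_apply, Measure.restrict_apply hs, Measure.restrict_apply hs,
      ← measure_inter_add_sdiff s hU]
    exact add_le_add (chartVolume_le x x₀ (hs.inter hU) Set.inter_subset_right)
      ((le_top : chartVolume (d := d) x ≤ ⊤) _)
  refine (h A).trans (le_of_eq ?_)
  rw [Measure.add_apply, Measure.restrict_apply hA, Measure.restrict_apply hA,
    Set.inter_eq_left.2 hA₀, (Set.disjoint_compl_right_iff_subset.2 hA₀).inter_eq]
  simp

omit [BorelSpace M] [IsManifold (𝓡∂ d) ∞ M] in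
theorem chartVolume_le_riemannianVolume (x : M) : chartVolume (d := d) x ≤ riemannianVolume d M :=
  le_iSup (fun x : M => chartVolume (d := d) x) x

omit [IsManifold (𝓡∂ d) ∞ M] in
theorem exists_weightedMeasure_le [CompactSpace M] {f : M → ℝ} (hf : Continuous f) :
    ∃ C : ℝ≥0, weightedMeasure d f ≤ C • riemannianVolume d M ∧
      riemannianVolume d M ≤ C • weightedMeasure d f := by
  obtain ⟨K, hK⟩ := (isCompact_univ (X := M)).exists_bound_of_continuousOn hf.continuousOn
  have hm : Measurable fun x => ENNReal.ofReal (Real.exp (-f x)) := by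
    have := hf.measurable
    fun_prop
  refine ⟨(Real.exp K).toNNReal, ?_, ?_⟩
  · have : weightedMeasure d f ≤
        (riemannianVolume d M).withDensity fun _ => ENNReal.ofReal (Real.exp K) := by
      refine withDensity_mono (Eventually.of_forall fun x => ?_)
      have := (abs_le.1 (hK x (Set.mem_univ x))).1
      exact ENNReal.ofReal_le_ofReal (Real.exp_le_exp.2 (by linarith))
    rw [withDensity_const] at this
    exact this
  · calc riemannianVolume d M = (riemannianVolume d M).withDensity 1 := withDensity_one.symm
      _ ≤ (riemannianVolume d M).withDensity
          (ENNReal.ofReal (Real.exp K) • fun x => ENNReal.ofReal (Real.exp (-f x))) := by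
        refine withDensity_mono (Eventually.of_forall fun x => ?_)
        have := (abs_le.1 (hK x (Set.mem_univ x))).2
        simp only [Pi.one_apply, Pi.smul_apply, smul_eq_mul]
        rw [← ENNReal.ofReal_mul (Real.exp_pos _).le, ← Real.exp_add, ← ENNReal.ofReal_one]
        exact ENNReal.ofReal_le_ofReal (Real.one_le_exp (by linarith))
      _ = ENNReal.ofReal (Real.exp K) • weightedMeasure d f := withDensity_smul _ hm

variable [IsContMDiffRiemannianBundle (𝓡∂ d) ∞ (EuclideanSpace ℝ (Fin d))
      (fun x : M => TangentSpace (𝓡∂ d) x)]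

/-- On a small coordinate ball (half ball at a boundary point) the weighted measure and Lebesgue
measure dominate each other up to a constant, and the Riemannian norm is dominated by the Euclidean
one. -/
theorem exists_chart_comparison [CompactSpace M] {f : M → ℝ} (hf : Continuous f) (x : M) :
    ∃ (r : ℝ) (C : ℝ≥0), 0 < r ∧
      Metric.ball (extChartAt (𝓡∂ d) x x) r ∩ Set.range (𝓡∂ d) ⊆ (extChartAt (𝓡∂ d) x).target ∧
      (∀ z ∈ Metric.ball (extChartAt (𝓡∂ d) x x) r ∩ Set.range (𝓡∂ d),
        ∀ w : EuclideanSpace ℝ (Fin d),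
        tangentNorm ((extChartAt (𝓡∂ d) x).symm z) (chartDeriv d x z w) ≤ C * ‖w‖) ∧
      (weightedMeasure d f).restrict ((extChartAt (𝓡∂ d) x).source ∩
          extChartAt (𝓡∂ d) x ⁻¹' Metric.ball (extChartAt (𝓡∂ d) x x) r) ≤
        C • (volume.restrict (Metric.ball (extChartAt (𝓡∂ d) x x) r ∩ Set.range (𝓡∂ d))).map
          (extChartAt (𝓡∂ d) x).symm ∧
      (volume.restrict (Metric.ball (extChartAt (𝓡∂ d) x x) r ∩ Set.range (𝓡∂ d))).map
          (extChartAt (𝓡∂ d) x).symm ≤ C • weightedMeasure d f := by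
  obtain ⟨K, hK1, hK2⟩ := exists_weightedMeasure_le (d := d) hf
  obtain ⟨G, hG, hGev⟩ := exists_eventually_sqrt_det_gramMatrix (d := d) x
  obtain ⟨N, hN, hNle⟩ := exists_tangentNorm_le (d := d) x
  obtain ⟨r, hr, hball⟩ := Metric.mem_nhdsWithin_iff.1 ((hGev.and
    (eventually_tangentNorm_chartDeriv x one_lt_two)).and (extChartAt_target_mem_nhdsWithin x))
  set D := Metric.ball (extChartAt (𝓡∂ d) x x) r ∩ Set.range (𝓡∂ d)
  have hD : D ⊆ (extChartAt (𝓡∂ d) x).target := fun z hz => (hball hz).2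
  have hDm : MeasurableSet D :=
    Metric.isOpen_ball.measurableSet.inter (𝓡∂ d).isClosed_range.measurableSet
  have hUo : IsOpen ((extChartAt (𝓡∂ d) x).source ∩
      extChartAt (𝓡∂ d) x ⁻¹' Metric.ball (extChartAt (𝓡∂ d) x x) r) :=
    (continuousOn_extChartAt x).isOpen_inter_preimage (isOpen_extChartAt_source x)
      Metric.isOpen_ball
  have hmap : ∀ A : Set M, MeasurableSet A →
      (volume.restrict D).map (extChartAt (𝓡∂ d) x).symm A =
        volume ((extChartAt (𝓡∂ d) x).symm ⁻¹' A ∩ D) := fun A hA => by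
    rw [Measure.map_apply_of_aemeasurable (aemeasurable_extChartAt_symm x hD) hA,
      Measure.restrict_apply' hDm]
  refine ⟨r, max (K * G.toNNReal) (2 * N).toNNReal, hr, hD, fun z hz w => ?_, ?_, ?_⟩
  · calc _ ≤ 2 * tangentNorm x w := ((hball hz).1.2 w).1
      _ ≤ 2 * (N * ‖w‖) := by gcongr; exact hNle w
      _ = (2 * N) * ‖w‖ := by ring
      _ ≤ _ := by
        gcongr
        push_cast
        exact (Real.coe_toNNReal _ (by positivity)).ge.trans (le_max_right _ _)
  · refine Measure.le_iff.2 fun A hA => ?_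
    rw [Measure.restrict_apply hA, Measure.smul_apply, hmap A hA]
    set U := (extChartAt (𝓡∂ d) x).source ∩
      extChartAt (𝓡∂ d) x ⁻¹' Metric.ball (extChartAt (𝓡∂ d) x x) r
    have hAU : MeasurableSet (A ∩ U) := hA.inter hUo.measurableSet
    have hsub : (extChartAt (𝓡∂ d) x).target ∩ (extChartAt (𝓡∂ d) x).symm ⁻¹' (A ∩ U) ⊆
        (extChartAt (𝓡∂ d) x).symm ⁻¹' A ∩ D := by
      rintro z ⟨hz, hzA, hzU⟩
      refine ⟨hzA, ?_, extChartAt_target_subset_range x hz⟩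
      have := hzU.2
      rwa [Set.mem_preimage, (extChartAt (𝓡∂ d) x).right_inv hz] at this
    calc weightedMeasure d f (A ∩ U) ≤ K * riemannianVolume d M (A ∩ U) := hK1 _
      _ ≤ K * chartVolume (d := d) x (A ∩ U) := by
        exact mul_le_mul' le_rfl (riemannianVolume_apply_le x hAU (fun y hy => hy.2.1))
      _ ≤ K * ∫⁻ z in (extChartAt (𝓡∂ d) x).symm ⁻¹' A ∩ D, ENNReal.ofReal G := by
        rw [chartVolume_apply x hAU]
        refine mul_le_mul' le_rfl ((setLIntegral_mono' (measurableSet_target_inter_preimage x hAU)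
          fun z hz => ENNReal.ofReal_le_ofReal ?_).trans (lintegral_mono_set hsub))
        exact (hball (hsub hz).2).1.1.1
      _ = ((K * G.toNNReal : ℝ≥0) : ℝ≥0∞) * volume ((extChartAt (𝓡∂ d) x).symm ⁻¹' A ∩ D) := by
        rw [setLIntegral_const, ENNReal.coe_mul, mul_assoc]
        rfl
      _ ≤ _ := by
        rw [ENNReal.smul_def, smul_eq_mul]
        gcongr
        exact le_max_left _ _
  · refine Measure.le_iff.2 fun A hA => ?_
    rw [Measure.smul_apply, hmap A hA]
    have hm : MeasurableSet ((extChartAt (𝓡∂ d) x).symm ⁻¹' A ∩ D) := by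
      have h := (measurableSet_target_inter_preimage x hA).inter hDm
      convert h using 1
      ext z
      exact ⟨fun h => ⟨⟨hD h.2, h.1⟩, h.2⟩, fun h => ⟨h.1.2, h.2⟩⟩
    calc volume ((extChartAt (𝓡∂ d) x).symm ⁻¹' A ∩ D)
        = ∫⁻ z in (extChartAt (𝓡∂ d) x).symm ⁻¹' A ∩ D, 1 := by simp
      _ ≤ ∫⁻ z in (extChartAt (𝓡∂ d) x).symm ⁻¹' A ∩ D,
          ENNReal.ofReal G * ENNReal.ofReal √(gramMatrix x z).det := by
        refine setLIntegral_mono' hm fun z hz => ?_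
        rw [← ENNReal.ofReal_mul hG.le, ← ENNReal.ofReal_one]
        exact ENNReal.ofReal_le_ofReal (hball hz.2).1.1.2
      _ ≤ ENNReal.ofReal G * chartVolume (d := d) x A := by
        rw [lintegral_const_mul' _ _ ENNReal.ofReal_ne_top, chartVolume_apply x hA]
        exact mul_le_mul' le_rfl (lintegral_mono_set fun z h => ⟨hD h.2, h.1⟩)
      _ ≤ ENNReal.ofReal G * (K * weightedMeasure d f A) := by
        gcongr
        exact (chartVolume_le_riemannianVolume x A).trans (hK2 A)
      _ = ((K * G.toNNReal : ℝ≥0) : ℝ≥0∞) * weightedMeasure d f A := by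
        rw [ENNReal.coe_mul, ← mul_assoc, mul_comm (K : ℝ≥0∞)]
        rfl
      _ ≤ _ := by
        rw [ENNReal.smul_def, smul_eq_mul]
        gcongr
        exact le_max_left _ _

end Volume

/-! ### Rellich's theorem in a chart -/

section Cells

variable {d : ℕ}

/-- The half-open cube of side `δ` with index `k` in the grid `δ ℤ^d`. -/
def gridCell (δ : ℝ) (k : Fin d → ℤ) : Set (EuclideanSpace ℝ (Fin d)) :=
  {z | ∀ i, ⌊z i / δ⌋ = k i}

theorem convex_gridCell (δ : ℝ) (k : Fin d → ℤ) : Convex ℝ (gridCell δ k) := by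
  intro z hz w hw a b ha hb hab i
  have h1 := Int.floor_eq_iff.1 (hz i)
  have h2 := Int.floor_eq_iff.1 (hw i)
  rw [Int.floor_eq_iff]
  have e : (a • z + b • w) i / δ = a * (z i / δ) + b * (w i / δ) := by
    simp only [PiLp.add_apply, PiLp.smul_apply, smul_eq_mul]
    ring
  rw [e]
  have hk : (k i : ℝ) = a * k i + b * k i := by rw [← add_mul, hab, one_mul]
  have hk1 : (k i : ℝ) + 1 = a * (k i + 1) + b * (k i + 1) := by rw [← add_mul, hab, one_mul]
  refine ⟨?_, ?_⟩
  · rw [hk]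
    gcongr
    · exact h1.1
    · exact h2.1
  · rw [hk1]
    rcases ha.eq_or_lt with rfl | ha
    · have hb1 : b = 1 := by linarith
      subst hb1
      linarith [h2.2]
    · have t1 := mul_lt_mul_of_pos_left h1.2 ha
      have t2 := mul_le_mul_of_nonneg_left h2.2.le hb
      linarith

theorem norm_sub_le_of_mem_gridCell {δ : ℝ} (hδ : 0 < δ) {k : Fin d → ℤ}
    {z w : EuclideanSpace ℝ (Fin d)} (hz : z ∈ gridCell δ k) (hw : w ∈ gridCell δ k) :
    ‖z - w‖ ≤ √d * δ := by
  have h : ∀ i, ‖(z - w) i‖ ^ 2 ≤ δ ^ 2 := by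
    intro i
    have h1 := Int.floor_eq_iff.1 (hz i)
    have h2 := Int.floor_eq_iff.1 (hw i)
    rw [le_div_iff₀ hδ, div_lt_iff₀ hδ] at h1 h2
    have h3 : |z i - w i| ≤ δ := by
      rw [abs_le]
      constructor <;> nlinarith
    rw [PiLp.sub_apply, Real.norm_eq_abs]
    gcongr
  rw [EuclideanSpace.norm_eq, ← Real.sqrt_sq hδ.le, ← Real.sqrt_mul (Nat.cast_nonneg d)]
  refine Real.sqrt_le_sqrt ((Finset.sum_le_sum fun i _ => h i).trans ?_)
  simp

theorem gridCell_disjoint (δ : ℝ) {k l : Fin d → ℤ} (h : k ≠ l) :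
    Disjoint (gridCell δ k) (gridCell δ l) := by
  rw [Set.disjoint_left]
  intro z hz hw
  exact h (funext fun i => (hz i).symm.trans (hw i))

theorem exists_subset_biUnion_gridCell {δ : ℝ} (hδ : 0 < δ) (a : EuclideanSpace ℝ (Fin d))
    (r : ℝ) : ∃ K : Finset (Fin d → ℤ), Metric.ball a r ⊆ ⋃ k ∈ K, gridCell δ k := by
  refine ⟨Finset.Icc (fun i => ⌊(a i - r) / δ⌋) (fun i => ⌊(a i + r) / δ⌋), fun z hz => ?_⟩
  have h : ∀ i, |z i - a i| ≤ r := fun i => by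
    have := PiLp.norm_apply_le (z - a) i
    rw [PiLp.sub_apply, Real.norm_eq_abs] at this
    rw [mem_ball_iff_norm] at hz
    linarith
  refine Set.mem_biUnion (x := fun i => ⌊z i / δ⌋) ?_ fun i => rfl
  rw [Finset.mem_coe, Finset.mem_Icc]
  refine ⟨fun i => Int.floor_le_floor ?_, fun i => Int.floor_le_floor ?_⟩ <;>
  · have := abs_le.1 (h i)
    gcongr
    linarith

end Cells

section Rellich

theorem lintegral_biUnion_finset_le {α ι : Type*} [MeasurableSpace α] {μ : Measure α}
    (K : Finset ι) (s : ι → Set α) (g : α → ℝ≥0∞) :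
    ∫⁻ a in ⋃ k ∈ K, s k, g a ∂μ ≤ ∑ k ∈ K, ∫⁻ a in s k, g a ∂μ := by
  classical
  induction K using Finset.induction_on with
  | empty => simp
  | insert k K hk ih =>
    rw [Finset.set_biUnion_insert, Finset.sum_insert hk]
    exact (lintegral_union_le _ _ _).trans (by gcongr)

variable {d : ℕ} [NeZero d] {M : Type*} [TopologicalSpace M]
  [ChartedSpace (EuclideanHalfSpace d) M] [MeasurableSpace M] [BorelSpace M]
  [RiemannianBundle (fun x : M => TangentSpace (𝓡∂ d) x)] [IsManifold (𝓡∂ d) ∞ M]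
  [IsContMDiffRiemannianBundle (𝓡∂ d) ∞ (EuclideanSpace ℝ (Fin d))
      (fun x : M => TangentSpace (𝓡∂ d) x)] [CompactSpace M]

omit [MeasurableSpace M] [BorelSpace M] [IsManifold (𝓡∂ d) ∞ M]
  [IsContMDiffRiemannianBundle (𝓡∂ d) ∞ (EuclideanSpace ℝ (Fin d))
    (fun x : M => TangentSpace (𝓡∂ d) x)] [CompactSpace M] in
theorem norm_differential_comp_le (φ : M → ℝ) {p : M} {C : ℝ≥0}
    {L : EuclideanSpace ℝ (Fin d) →L[ℝ] EuclideanSpace ℝ (Fin d)}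
    (hL : ∀ w, tangentNorm p (L w) ≤ C * ‖w‖) :
    ‖(differential d φ p).comp L‖ ≤ C * normGrad d φ p := by
  refine ContinuousLinearMap.opNorm_le_bound _
    (mul_nonneg C.coe_nonneg (normGrad_nonneg _ _)) fun w => ?_
  have h := abs_le_cotangentNorm p (differential d φ p) (L w)
  rw [← normGrad_eq] at h
  refine h.trans ((mul_le_mul_of_nonneg_left (hL w) (normGrad_nonneg _ _)).trans_eq ?_)
  ring

/-- The local form of Rellich's theorem: near `x`, the `L²` norm is controlled by an arbitrarily
small multiple of the energy together with finitely many bounded functionals, namely the integrals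
over the cells of a fine grid in a chart. -/
theorem exists_local_functionals {f : M → ℝ} (hf : Continuous f) (x : M) :
    ∃ U : Set M, IsOpen U ∧ x ∈ U ∧ ∀ ε : ℝ≥0, 0 < ε →
      ∃ (T : Finset (Fin d → ℤ)) (ℓ : (Fin d → ℤ) → (M → ℝ) → ℝ) (c : ℝ≥0),
        (∀ k u v, Continuous u → Continuous v → ℓ k (u - v) = ℓ k u - ℓ k v) ∧
        (∀ k u, Continuous u → ‖ℓ k u‖ₑ ^ 2 ≤ c * ∫⁻ y, ‖u y‖ₑ ^ 2 ∂weightedMeasure d f) ∧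
        ∀ u, ContMDiff (𝓡∂ d) 𝓘(ℝ, ℝ) 1 u →
          ∫⁻ y in U, ‖u y‖ₑ ^ 2 ∂weightedMeasure d f ≤
            ε * ∫⁻ y, ‖normGrad d u y‖ₑ ^ 2 ∂weightedMeasure d f +
              c * ∑ k ∈ T, ‖ℓ k u‖ₑ ^ 2 := by
  obtain ⟨r, C, hr, hDt, hnorm, hm1, hm2⟩ := exists_chart_comparison (d := d) hf x
  set m := weightedMeasure d f
  set e := extChartAt (𝓡∂ d) x
  set D := Metric.ball (e x) r ∩ Set.range (𝓡∂ d)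
  set U := e.source ∩ e ⁻¹' Metric.ball (e x) r
  have hDc : Convex ℝ D := (convex_ball _ _).inter (𝓡∂ d).convex_range
  have hDm : MeasurableSet D :=
    Metric.isOpen_ball.measurableSet.inter (𝓡∂ d).isClosed_range.measurableSet
  have hDfin : volume D ≠ ⊤ :=
    ((measure_mono Set.inter_subset_left).trans_lt measure_ball_lt_top).ne
  have hsymm : AEMeasurable e.symm (volume.restrict D) := aemeasurable_extChartAt_symm x hDt
  have hcomp : ∀ h : M → ℝ, Continuous h →
      ∫⁻ z in D, ‖h (e.symm z)‖ₑ ^ 2 ≤ C * ∫⁻ y, ‖h y‖ₑ ^ 2 ∂m := by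
    intro h hh
    have hmeas : Measurable fun y => ‖h y‖ₑ ^ 2 := hh.measurable.enorm.pow_const 2
    rw [← lintegral_map' hmeas.aemeasurable hsymm]
    refine (lintegral_mono' hm2 le_rfl).trans (le_of_eq ?_)
    rw [lintegral_smul_measure]
    rfl
  have hint : ∀ h : M → ℝ, Continuous h → IntegrableOn (h ∘ e.symm) D := by
    intro h hh
    obtain ⟨B, hB⟩ := (isCompact_univ (X := M)).exists_bound_of_continuousOn hh.continuousOn
    have : IsFiniteMeasure (volume.restrict D) :=
      ⟨by rw [Measure.restrict_apply_univ]; exact hDfin.lt_top⟩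
    exact Integrable.of_bound (hh.measurable.comp_aemeasurable hsymm).aestronglyMeasurable B
      (Eventually.of_forall fun z => hB _ (Set.mem_univ _))
  refine ⟨U, (continuousOn_extChartAt x).isOpen_inter_preimage (isOpen_extChartAt_source x)
    Metric.isOpen_ball, ⟨mem_extChartAt_source x, Metric.mem_ball_self hr⟩, fun ε hε => ?_⟩
  -- the side of the cells is chosen so that the Poincaré inequality has a small constant
  obtain ⟨δ, hδ, hδε⟩ : ∃ δ : ℝ, 0 < δ ∧ (C : ℝ≥0∞) * (2 * 2 ^ d *
      ENNReal.ofReal (√d * δ) ^ 2 * (C ^ 2 * C)) ≤ ε := by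
    have hlim : Tendsto (fun δ : ℝ => (C : ℝ≥0∞) * (2 * 2 ^ d *
      ENNReal.ofReal (√d * δ) ^ 2 * (C ^ 2 * C))) (𝓝[>] 0) (𝓝 0) := by
      have h1 : Continuous fun δ : ℝ => (C : ℝ≥0∞) * (2 * 2 ^ d *
          ENNReal.ofReal (√d * δ) ^ 2 * (C ^ 2 * C)) := by
        have h2 : Continuous fun δ : ℝ => ENNReal.ofReal (√d * δ) ^ 2 :=
          (ENNReal.continuous_pow 2).comp (ENNReal.continuous_ofReal.comp (by fun_prop))
        refine ENNReal.continuous_const_mul ENNReal.coe_ne_top |>.comp ?_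
        refine (ENNReal.continuous_mul_const (by finiteness)).comp ?_
        exact (ENNReal.continuous_const_mul (by finiteness)).comp h2
      have h3 := h1.tendsto 0
      simp only [mul_zero, ENNReal.ofReal_zero, ne_eq, OfNat.ofNat_ne_zero, not_false_eq_true,
        zero_pow, zero_mul] at h3
      exact h3.mono_left nhdsWithin_le_nhds
    obtain ⟨δ, h1, h2⟩ := ((hlim.eventually_lt_const (ENNReal.coe_pos.2 hε)).and
      self_mem_nhdsWithin).exists
    exact ⟨δ, h2, h1.le⟩
  obtain ⟨K, hK⟩ := exists_subset_biUnion_gridCell hδ (e x) r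
  -- passing to the interior is harmless, as the frontier of a convex set is a null set
  set O : (Fin d → ℤ) → Set (EuclideanSpace ℝ (Fin d)) := fun k => interior (gridCell δ k ∩ D)
  have hOD : ∀ k, O k ⊆ D := fun k => interior_subset.trans Set.inter_subset_right
  have hOc : ∀ k, Convex ℝ (O k) := fun k => ((convex_gridCell δ k).inter hDc).interior
  have hOae : ∀ k, (gridCell δ k ∩ D : Set _) =ᵐ[volume] O k := fun k =>
    (interior_ae_eq_of_null_frontier
      (((convex_gridCell δ k).inter hDc).addHaar_frontier volume)).symm
  have hOfin : ∀ k, volume (O k) ≠ ⊤ := fun k =>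
    ((measure_mono (hOD k)).trans_lt hDfin.lt_top).ne
  have hOdisj : Set.PairwiseDisjoint (K : Set (Fin d → ℤ)) O := fun k _ l _ hkl =>
    (gridCell_disjoint δ hkl).mono (interior_subset.trans Set.inter_subset_left)
      (interior_subset.trans Set.inter_subset_left)
  have hpoincare : ∀ k u, ContMDiff (𝓡∂ d) 𝓘(ℝ, ℝ) 1 u →
      ∫⁻ z in O k, ‖u (e.symm z)‖ₑ ^ 2 ≤
        2 * 2 ^ d * ENNReal.ofReal (√d * δ) ^ 2 *
          (∫⁻ z in O k, (C * ‖normGrad d u (e.symm z)‖ₑ) ^ 2) +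
        2 * (volume (O k))⁻¹ * ‖∫ z in O k, u (e.symm z)‖ₑ ^ 2 := by
    intro k u hu
    have h := lintegral_enorm_sq_le_of_convex volume isOpen_interior (hOc k)
      ((contDiffOn_comp_extChartAt_symm x (by simp) hu).mono ((hOD k).trans hDt))
      (D := ENNReal.ofReal (√d * δ)) (fun z hz w hw => by
        rw [← ofReal_norm]
        exact ENNReal.ofReal_le_ofReal (norm_sub_le_of_mem_gridCell hδ
          (interior_subset hz).1 (interior_subset hw).1))
      (hOfin k) ((hint u hu.continuous).mono_set (hOD k))
    rw [finrank_euclideanSpace_fin] at h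
    refine h.trans ?_
    refine add_le_add_left (mul_le_mul' le_rfl
      (setLIntegral_mono' isOpen_interior.measurableSet fun z hz => ?_)) _
    gcongr
    have hzD := hOD k hz
    have hd := (hasFDerivWithinAt_comp_extChartAt_symm (hDt hzD)
      ((hu.mdifferentiable one_ne_zero) _)).hasFDerivAt
        (mem_of_superset (isOpen_interior.mem_nhds hz) fun w hw => (hOD k hw).2)
    rw [hd.fderiv, ← ofReal_norm, Real.enorm_of_nonneg (normGrad_nonneg _ _),
      ← ENNReal.ofReal_coe_nnreal, ← ENNReal.ofReal_mul C.coe_nonneg]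
    exact ENNReal.ofReal_le_ofReal (norm_differential_comp_le u (hnorm z hzD))
  have hempty : ∀ k, volume (O k) = 0 → O k = ∅ := fun k hk =>
    isOpen_interior.measure_eq_zero_iff volume |>.1 hk
  refine ⟨K, fun k u => ∫ z in O k, u (e.symm z),
    (volume D).toNNReal * C + ∑ k ∈ K, (C * (2 * (volume (O k))⁻¹)).toNNReal,
    fun k u v hu hv => integral_sub ((hint u hu).mono_set (hOD k)) ((hint v hv).mono_set (hOD k)),
    fun k u hu => ?_, fun u hu => ?_⟩
  · have hmeas : AEMeasurable (fun z => ‖u (e.symm z)‖ₑ) (volume.restrict (O k)) :=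
      ((hu.measurable.comp_aemeasurable hsymm).mono_measure
        (Measure.restrict_mono (hOD k) le_rfl)).enorm
    calc ‖∫ z in O k, u (e.symm z)‖ₑ ^ 2 ≤ (∫⁻ z in O k, ‖u (e.symm z)‖ₑ) ^ 2 := by
          gcongr; exact enorm_integral_le_lintegral_enorm _
      _ ≤ volume (O k) * ∫⁻ z in O k, ‖u (e.symm z)‖ₑ ^ 2 := by
          have h := sq_lintegral_le_mul_lintegral_sq hmeas
          rwa [Measure.restrict_apply_univ] at h
      _ ≤ volume D * ∫⁻ z in D, ‖u (e.symm z)‖ₑ ^ 2 :=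
          mul_le_mul' (measure_mono (hOD k)) (lintegral_mono_set (hOD k))
      _ ≤ volume D * (C * ∫⁻ y, ‖u y‖ₑ ^ 2 ∂m) := mul_le_mul' le_rfl (hcomp u hu)
      _ = (((volume D).toNNReal * C : ℝ≥0) : ℝ≥0∞) * ∫⁻ y, ‖u y‖ₑ ^ 2 ∂m := by
          rw [ENNReal.coe_mul, ENNReal.coe_toNNReal hDfin, mul_assoc]
      _ ≤ _ := by gcongr; exact le_self_add
  · have hcov : D ⊆ ⋃ k ∈ K, gridCell δ k ∩ D := by
      intro z hz
      obtain ⟨k, hk, hzk⟩ := Set.mem_iUnion₂.1 (hK hz.1)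
      exact Set.mem_biUnion hk ⟨hzk, hz⟩
    have hgrad : ∑ k ∈ K, ∫⁻ z in O k, (C * ‖normGrad d u (e.symm z)‖ₑ) ^ 2 ≤
        C ^ 2 * (C * ∫⁻ y, ‖normGrad d u y‖ₑ ^ 2 ∂m) := by
      rw [← lintegral_biUnion_finset hOdisj (fun k _ => isOpen_interior.measurableSet)]
      refine (lintegral_mono_set (Set.iUnion₂_subset fun k _ => hOD k)).trans ?_
      simp_rw [mul_pow]
      rw [lintegral_const_mul' _ _ (by finiteness)]
      exact mul_le_mul' le_rfl (hcomp _ (continuous_normGrad hu))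
    have hmeas : Measurable fun y => ‖u y‖ₑ ^ 2 := hu.continuous.measurable.enorm.pow_const 2
    calc ∫⁻ y in U, ‖u y‖ₑ ^ 2 ∂m ≤ C * ∫⁻ z in D, ‖u (e.symm z)‖ₑ ^ 2 := by
          refine (lintegral_mono' hm1 le_rfl).trans (le_of_eq ?_)
          rw [ENNReal.smul_def, lintegral_smul_measure, lintegral_map' hmeas.aemeasurable hsymm]
          rfl
      _ ≤ C * ∑ k ∈ K, ∫⁻ z in gridCell δ k ∩ D, ‖u (e.symm z)‖ₑ ^ 2 :=
          mul_le_mul' le_rfl ((lintegral_mono_set hcov).trans (lintegral_biUnion_finset_le _ _ _))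
      _ = C * ∑ k ∈ K, ∫⁻ z in O k, ‖u (e.symm z)‖ₑ ^ 2 := by
          congr 1
          exact Finset.sum_congr rfl fun k _ => setLIntegral_congr (hOae k)
      _ ≤ C * ∑ k ∈ K, (2 * 2 ^ d * ENNReal.ofReal (√d * δ) ^ 2 *
            (∫⁻ z in O k, (C * ‖normGrad d u (e.symm z)‖ₑ) ^ 2) +
            2 * (volume (O k))⁻¹ * ‖∫ z in O k, u (e.symm z)‖ₑ ^ 2) :=
          mul_le_mul' le_rfl (Finset.sum_le_sum fun k _ => hpoincare k u hu)
      _ = C * (2 * 2 ^ d * ENNReal.ofReal (√d * δ) ^ 2 *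
            ∑ k ∈ K, ∫⁻ z in O k, (C * ‖normGrad d u (e.symm z)‖ₑ) ^ 2) +
            ∑ k ∈ K, C * (2 * (volume (O k))⁻¹) * ‖∫ z in O k, u (e.symm z)‖ₑ ^ 2 := by
          rw [Finset.sum_add_distrib, mul_add, ← Finset.mul_sum]
          congr 1
          rw [Finset.mul_sum]
          exact Finset.sum_congr rfl fun k _ => (mul_assoc _ _ _).symm
      _ ≤ ε * ∫⁻ y, ‖normGrad d u y‖ₑ ^ 2 ∂m + _ := by
          gcongr ?_ + ?_
          · refine (mul_le_mul' le_rfl (mul_le_mul' le_rfl hgrad)).trans ?_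
            calc _ = (C : ℝ≥0∞) * (2 * 2 ^ d * ENNReal.ofReal (√d * δ) ^ 2 * (C ^ 2 * C)) *
                  ∫⁻ y, ‖normGrad d u y‖ₑ ^ 2 ∂m := by ring
              _ ≤ _ := mul_le_mul' hδε le_rfl
          · rw [Finset.mul_sum]
            refine Finset.sum_le_sum fun k hk => ?_
            rcases eq_or_ne (volume (O k)) 0 with h0 | h0
            · simp [hempty k h0]
            · refine mul_le_mul' ?_ le_rfl
              rw [← ENNReal.coe_toNNReal (a := C * (2 * (volume (O k))⁻¹)) (by finiteness)]
              refine ENNReal.coe_le_coe.2 ?_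
              refine (Finset.single_le_sum (f := fun k => (C * (2 * (volume (O k))⁻¹)).toNNReal)
                (fun _ _ => zero_le) hk).trans le_add_self

end Rellich

/-! ### The Dirichlet form -/

section Form

variable {d : ℕ} [NeZero d] {M : Type*} [TopologicalSpace M]
  [ChartedSpace (EuclideanHalfSpace d) M]

theorem IsTestFunction.contMDiff_one {u : M → ℝ} (hu : IsTestFunction d u) :
    ContMDiff (𝓡∂ d) 𝓘(ℝ, ℝ) 1 u := hu.1.of_le (by simp)

theorem IsTestFunction.add {u v : M → ℝ} (hu : IsTestFunction d u) (hv : IsTestFunction d v) :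
    IsTestFunction d (u + v) :=
  ⟨hu.1.add hv.1, hu.2.1.add hv.2.1,
    (tsupport_add u v).trans (Set.union_subset hu.2.2 hv.2.2)⟩

theorem IsTestFunction.smul {u : M → ℝ} (hu : IsTestFunction d u) (c : ℝ) :
    IsTestFunction d (c • u) :=
  ⟨(contDiff_const_smul c).contMDiff.comp hu.1, hu.2.1.smul_left (f := fun _ => c),
    (tsupport_smul_subset_right (fun _ => c) u).trans hu.2.2⟩

variable [MeasurableSpace M] [RiemannianBundle (fun x : M => TangentSpace (𝓡∂ d) x)]
  {f : M → ℝ} {u v w : M → ℝ}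

theorem dirichletForm_smul_left (hu : ContMDiff (𝓡∂ d) 𝓘(ℝ, ℝ) 1 u) (c : ℝ) :
    dirichletForm d f (c • u) w = c * dirichletForm d f u w := by
  rw [dirichletForm, dirichletForm, ← integral_const_mul]
  exact integral_congr_ae (Eventually.of_forall fun x => inner_grad_smul_left
    ((hu.mdifferentiable one_ne_zero) x) c)

theorem dirichletForm_comm : dirichletForm d f u v = dirichletForm d f v u :=
  integral_congr_ae (Eventually.of_forall fun x => inner_grad_comm u v x)

theorem dirichletForm_self : dirichletForm d f u u = ∫ x, normGrad d u x ^ 2 ∂weightedMeasure d f :=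
  integral_congr_ae (Eventually.of_forall fun x => inner_grad_self u x)

theorem dirichletForm_self_nonneg : 0 ≤ dirichletForm d f u u := by
  rw [dirichletForm_self]
  exact integral_nonneg fun x => sq_nonneg _

omit [ChartedSpace (EuclideanHalfSpace d) M]
    [RiemannianBundle (fun x : M => TangentSpace (𝓡∂ d) x)] in
theorem integrable_of_continuous [BorelSpace M] [CompactSpace M] {m : Measure M}
    [IsFiniteMeasure m] {h : M → ℝ} (hh : Continuous h) : Integrable h m :=
  hh.integrable_of_hasCompactSupport (HasCompactSupport.of_compactSpace h)

omit [ChartedSpace (EuclideanHalfSpace d) M]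
    [RiemannianBundle (fun x : M => TangentSpace (𝓡∂ d) x)] in
theorem lintegral_enorm_sq [BorelSpace M] [CompactSpace M] {m : Measure M} [IsFiniteMeasure m]
    (hu : Continuous u) : ∫⁻ y, ‖u y‖ₑ ^ 2 ∂m = ENNReal.ofReal (∫ y, u y ^ 2 ∂m) := by
  rw [ofReal_integral_eq_lintegral_ofReal (f := fun y => u y ^ 2)
    (integrable_of_continuous (hu.pow 2)) (Eventually.of_forall fun x => sq_nonneg _)]
  refine lintegral_congr fun x => ?_
  rw [← ofReal_norm, ← ENNReal.ofReal_pow (norm_nonneg _), Real.norm_eq_abs, sq_abs]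

variable [BorelSpace M]
  [IsManifold (𝓡∂ d) ∞ M]
  [IsContMDiffRiemannianBundle (𝓡∂ d) ∞ (EuclideanSpace ℝ (Fin d))
      (fun x : M => TangentSpace (𝓡∂ d) x)] [CompactSpace M]
  [IsFiniteMeasure (weightedMeasure d f)]

theorem dirichletForm_add_left (hu : ContMDiff (𝓡∂ d) 𝓘(ℝ, ℝ) 1 u)
    (hv : ContMDiff (𝓡∂ d) 𝓘(ℝ, ℝ) 1 v) (hw : ContMDiff (𝓡∂ d) 𝓘(ℝ, ℝ) 1 w) :
    dirichletForm d f (u + v) w = dirichletForm d f u w + dirichletForm d f v w := by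
  rw [dirichletForm, dirichletForm, dirichletForm, ← integral_add
    (integrable_of_continuous (continuous_inner_grad hu hw))
    (integrable_of_continuous (continuous_inner_grad hv hw))]
  exact integral_congr_ae (Eventually.of_forall fun x => inner_grad_add_left
    ((hu.mdifferentiable one_ne_zero) x) ((hv.mdifferentiable one_ne_zero) x))

theorem dirichletForm_add_smul (hu : ContMDiff (𝓡∂ d) 𝓘(ℝ, ℝ) 1 u)
    (hv : ContMDiff (𝓡∂ d) 𝓘(ℝ, ℝ) 1 v) (c : ℝ) :
    dirichletForm d f (u + c • v) (u + c • v) =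
      dirichletForm d f u u + 2 * c * dirichletForm d f u v + c ^ 2 * dirichletForm d f v v := by
  have hcv : ContMDiff (𝓡∂ d) 𝓘(ℝ, ℝ) 1 (c • v) :=
    (contDiff_const_smul c).contMDiff.comp hv
  rw [dirichletForm_add_left hu hcv (hu.add hcv), dirichletForm_smul_left hv,
    dirichletForm_comm (v := u + c • v), dirichletForm_comm (v := u + c • v),
    dirichletForm_add_left hu hcv hu, dirichletForm_add_left hu hcv hv,
    dirichletForm_smul_left hv, dirichletForm_smul_left hv, dirichletForm_comm (u := v) (v := u)]
  ring

theorem dirichletForm_sub_self (hu : ContMDiff (𝓡∂ d) 𝓘(ℝ, ℝ) 1 u)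
    (hv : ContMDiff (𝓡∂ d) 𝓘(ℝ, ℝ) 1 v) :
    dirichletForm d f (u - v) (u - v) =
      dirichletForm d f u u - 2 * dirichletForm d f u v + dirichletForm d f v v := by
  have h := dirichletForm_add_smul (f := f) hu hv (-1)
  rw [neg_one_smul, ← sub_eq_add_neg] at h
  rw [h]
  ring

theorem dirichletForm_add_self (hu : ContMDiff (𝓡∂ d) 𝓘(ℝ, ℝ) 1 u)
    (hv : ContMDiff (𝓡∂ d) 𝓘(ℝ, ℝ) 1 v) :
    dirichletForm d f (u + v) (u + v) =
      dirichletForm d f u u + 2 * dirichletForm d f u v + dirichletForm d f v v := by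
  have h := dirichletForm_add_smul (f := f) hu hv 1
  rw [one_smul] at h
  rw [h]
  ring

theorem lintegral_enorm_normGrad_sq (hu : ContMDiff (𝓡∂ d) 𝓘(ℝ, ℝ) 1 u) :
    ∫⁻ y, ‖normGrad d u y‖ₑ ^ 2 ∂weightedMeasure d f = ENNReal.ofReal (dirichletForm d f u u) := by
  rw [dirichletForm_self, ofReal_integral_eq_lintegral_ofReal
    (f := fun y => normGrad d u y ^ 2) (integrable_of_continuous ((continuous_normGrad hu).pow 2))
    (Eventually.of_forall fun x => sq_nonneg _)]
  refine lintegral_congr fun x => ?_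
  rw [Real.enorm_of_nonneg (normGrad_nonneg _ _), ENNReal.ofReal_pow (normGrad_nonneg _ _)]

/-- The `L²` norm is controlled by an arbitrarily small multiple of the energy together with
finitely many bounded functionals. -/
theorem exists_functionals (hf : Continuous f) {ε : ℝ} (hε : 0 < ε) :
    ∃ (T : Finset (Σ _ : M, Fin d → ℤ)) (ℓ : (Σ _ : M, Fin d → ℤ) → (M → ℝ) → ℝ) (c : ℝ), 0 ≤ c ∧
      (∀ k u v, Continuous u → Continuous v → ℓ k (u - v) = ℓ k u - ℓ k v) ∧
      (∀ k ∈ T, ∀ u, Continuous u → ℓ k u ^ 2 ≤ c * ∫ y, u y ^ 2 ∂weightedMeasure d f) ∧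
      ∀ u, ContMDiff (𝓡∂ d) 𝓘(ℝ, ℝ) 1 u →
        ∫ y, u y ^ 2 ∂weightedMeasure d f ≤
          ε * dirichletForm d f u u + c * ∑ k ∈ T, ℓ k u ^ 2 := by
  classical
  choose U hUo hxU hU using exists_local_functionals (d := d) (M := M) hf
  obtain ⟨t, ht⟩ := isCompact_univ.elim_finite_subcover U hUo
    (fun x _ => Set.mem_iUnion.2 ⟨x, hxU x⟩)
  set δ : ℝ≥0 := (ε / (t.card + 1)).toNNReal
  have hδ : 0 < δ := Real.toNNReal_pos.2 (by positivity)
  have hδc : (δ : ℝ) = ε / (t.card + 1) := Real.coe_toNNReal _ (by positivity)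
  choose T ℓ c h1 h2 h3 using fun x => hU x δ hδ
  have hc : ∀ x ∈ t, c x ≤ ∑ x ∈ t, c x := fun x hx =>
    Finset.single_le_sum (f := c) (fun _ _ => zero_le) hx
  refine ⟨t.sigma T, fun k => ℓ k.1 k.2, (∑ x ∈ t, c x : ℝ≥0), NNReal.coe_nonneg _,
    fun k => h1 k.1 k.2, fun k hk u hu => ?_, fun u hu => ?_⟩
  · have h := h2 k.1 k.2 u hu
    rw [lintegral_enorm_sq hu, ← ofReal_norm, ← ENNReal.ofReal_pow (norm_nonneg _),
      Real.norm_eq_abs, sq_abs, ← ENNReal.ofReal_coe_nnreal,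
      ← ENNReal.ofReal_mul (NNReal.coe_nonneg _)] at h
    have hI : 0 ≤ ∫ y, u y ^ 2 ∂weightedMeasure d f := integral_nonneg fun x => sq_nonneg _
    refine ((ENNReal.ofReal_le_ofReal_iff (mul_nonneg (NNReal.coe_nonneg _) hI)).1 h).trans ?_
    refine mul_le_mul_of_nonneg_right ?_ hI
    exact_mod_cast hc k.1 (Finset.mem_sigma.1 hk).1
  · have hE := dirichletForm_self_nonneg (d := d) (f := f) (u := u)
    have hterm : ∀ x ∈ t, ∫⁻ y in U x, ‖u y‖ₑ ^ 2 ∂weightedMeasure d f ≤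
        ENNReal.ofReal (δ * dirichletForm d f u u +
          (∑ x ∈ t, c x : ℝ≥0) * ∑ k ∈ T x, ℓ x k u ^ 2) := by
      intro x hx
      refine (h3 x u hu).trans ?_
      have hs : ∑ k ∈ T x, ‖ℓ x k u‖ₑ ^ 2 = ENNReal.ofReal (∑ k ∈ T x, ℓ x k u ^ 2) := by
        rw [ENNReal.ofReal_sum_of_nonneg fun _ _ => sq_nonneg _]
        refine Finset.sum_congr rfl fun k _ => ?_
        rw [← ofReal_norm, ← ENNReal.ofReal_pow (norm_nonneg _), Real.norm_eq_abs, sq_abs]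
      have hs0 : 0 ≤ ∑ k ∈ T x, ℓ x k u ^ 2 := Finset.sum_nonneg fun _ _ => sq_nonneg _
      rw [lintegral_enorm_normGrad_sq hu, hs, ENNReal.ofReal_add (by positivity) (by positivity),
        ENNReal.ofReal_mul (NNReal.coe_nonneg _), ENNReal.ofReal_mul (NNReal.coe_nonneg _),
        ENNReal.ofReal_coe_nnreal, ENNReal.ofReal_coe_nnreal]
      gcongr
      exact hc x hx
    have hsum : ENNReal.ofReal (∫ y, u y ^ 2 ∂weightedMeasure d f) ≤
        ∑ x ∈ t, ENNReal.ofReal (δ * dirichletForm d f u u +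
          (∑ x ∈ t, c x : ℝ≥0) * ∑ k ∈ T x, ℓ x k u ^ 2) := by
      rw [← lintegral_enorm_sq hu.continuous, ← setLIntegral_univ]
      exact (lintegral_mono_set ht).trans
        ((lintegral_biUnion_finset_le _ _ _).trans (Finset.sum_le_sum hterm))
    have hpos : ∀ x ∈ t, 0 ≤ δ * dirichletForm d f u u +
          (∑ x ∈ t, c x : ℝ≥0) * ∑ k ∈ T x, ℓ x k u ^ 2 := fun x _ => by
      have : 0 ≤ ∑ k ∈ T x, ℓ x k u ^ 2 := Finset.sum_nonneg fun _ _ => sq_nonneg _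
      positivity
    rw [← ENNReal.ofReal_sum_of_nonneg hpos,
      ENNReal.ofReal_le_ofReal_iff (Finset.sum_nonneg hpos)] at hsum
    refine hsum.trans ?_
    rw [Finset.sum_add_distrib, Finset.sum_const, nsmul_eq_mul, ← Finset.mul_sum,
      Finset.sum_sigma, hδc, ← mul_assoc]
    gcongr
    rw [mul_div_assoc', div_le_iff₀ (by positivity)]
    nlinarith

end Form

/-! ### The first Dirichlet eigenvalue -/

section Eigenvalue

variable {d : ℕ} [NeZero d] {M : Type*} [TopologicalSpace M]
  [ChartedSpace (EuclideanHalfSpace d) M] [MeasurableSpace M] [BorelSpace M]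
  [RiemannianBundle (fun x : M => TangentSpace (𝓡∂ d) x)] [IsManifold (𝓡∂ d) ∞ M]
  [IsContMDiffRiemannianBundle (𝓡∂ d) ∞ (EuclideanSpace ℝ (Fin d))
      (fun x : M => TangentSpace (𝓡∂ d) x)] [CompactSpace M]
  {f : M → ℝ} [IsFiniteMeasure (weightedMeasure d f)]

/-- Rellich's theorem: a sequence that is bounded in `L²` and in energy has a subsequence that is
Cauchy in `L²`. The subsequence is chosen so that each of the countably many functionals that belong
to the scales `1 / (n + 1)` converges along it. -/
theorem exists_subseq_cauchy (hf : Continuous f) {u : ℕ → M → ℝ}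
    (hu : ∀ j, ContMDiff (𝓡∂ d) 𝓘(ℝ, ℝ) 1 (u j)) {A B : ℝ}
    (hA : ∀ j, ∫ y, u j y ^ 2 ∂weightedMeasure d f ≤ A)
    (hB : ∀ j, dirichletForm d f (u j) (u j) ≤ B) :
    ∃ κ : ℕ → ℕ, StrictMono κ ∧ ∀ ε : ℝ, 0 < ε → ∃ N, ∀ j ≥ N, ∀ k ≥ N,
      ∫ y, (u (κ j) - u (κ k)) y ^ 2 ∂weightedMeasure d f < ε := by
  choose T ℓ c hc hsub hbd hest using fun n : ℕ =>
    exists_functionals (d := d) hf (Nat.one_div_pos_of_nat (α := ℝ) (n := n))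
  let J := Σ n : ℕ, {k // k ∈ T n}
  let F : ℕ → J → ℝ := fun j a => ℓ a.1 a.2.1 (u j)
  have hF : ∀ j, F j ∈ Set.pi Set.univ fun a : J =>
      Set.Icc (-√(c a.1 * A)) √(c a.1 * A) := by
    intro j a _
    rw [Set.mem_Icc, ← abs_le]
    refine Real.abs_le_sqrt ((hbd a.1 a.2.1 a.2.2 _ (hu j).continuous).trans ?_)
    exact mul_le_mul_of_nonneg_left (hA j) (hc a.1)
  obtain ⟨L, -, κ, hκ, hlim⟩ := (isCompact_univ_pi fun a : J => isCompact_Icc).tendsto_subseq hF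
  refine ⟨κ, hκ, fun ε hε => ?_⟩
  have hB0 : 0 ≤ B := dirichletForm_self_nonneg.trans (hB 0)
  obtain ⟨n, hn⟩ : ∃ n : ℕ, 1 / ((n : ℝ) + 1) * (4 * B) < ε / 2 := by
    have h1 : Tendsto (fun n : ℕ => 1 / ((n : ℝ) + 1) * (4 * B)) atTop (𝓝 (0 * (4 * B))) :=
      tendsto_one_div_add_atTop_nhds_zero_nat.mul_const _
    rw [zero_mul] at h1
    exact (h1.eventually_lt_const (by positivity)).exists
  have hsum : Tendsto (fun p : ℕ × ℕ => c n * ∑ k ∈ T n,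
      (ℓ n k (u (κ p.1)) - ℓ n k (u (κ p.2))) ^ 2) (atTop ×ˢ atTop) (𝓝 0) := by
    have hk : ∀ k ∈ T n, Tendsto (fun p : ℕ × ℕ =>
        (ℓ n k (u (κ p.1)) - ℓ n k (u (κ p.2))) ^ 2) (atTop ×ˢ atTop) (𝓝 0) := by
      intro k hk
      have h1 : Tendsto (fun j => ℓ n k (u (κ j))) atTop (𝓝 (L ⟨n, k, hk⟩)) :=
        (tendsto_pi_nhds.1 hlim) ⟨n, k, hk⟩
      have h2 := ((h1.comp tendsto_fst).sub (h1.comp tendsto_snd) :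
        Tendsto _ ((atTop : Filter ℕ) ×ˢ (atTop : Filter ℕ)) _).pow 2
      rw [sub_self, zero_pow two_ne_zero] at h2
      exact h2
    simpa using (tendsto_finsetSum _ hk).const_mul (c n)
  have hev := hsum.eventually_lt_const (half_pos hε)
  rw [prod_atTop_atTop_eq, eventually_atTop] at hev
  obtain ⟨⟨N₁, N₂⟩, hN⟩ := hev
  refine ⟨max N₁ N₂, fun j hj k hk => ?_⟩
  have hjk := hN (j, k) ⟨(le_max_left _ _).trans hj, (le_max_right _ _).trans hk⟩
  have hE : dirichletForm d f (u (κ j) - u (κ k)) (u (κ j) - u (κ k)) ≤ 4 * B := by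
    have h1 := dirichletForm_sub_self (f := f) (hu (κ j)) (hu (κ k))
    have h2 := dirichletForm_add_self (f := f) (hu (κ j)) (hu (κ k))
    have h3 := dirichletForm_self_nonneg (f := f) (d := d) (u := u (κ j) + u (κ k))
    linarith [hB (κ j), hB (κ k)]
  calc ∫ y, (u (κ j) - u (κ k)) y ^ 2 ∂weightedMeasure d f
      ≤ 1 / ((n : ℝ) + 1) * dirichletForm d f (u (κ j) - u (κ k)) (u (κ j) - u (κ k)) +
          c n * ∑ i ∈ T n, ℓ n i (u (κ j) - u (κ k)) ^ 2 := hest n _ ((hu _).sub (hu _))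
    _ ≤ 1 / ((n : ℝ) + 1) * (4 * B) +
          c n * ∑ i ∈ T n, (ℓ n i (u (κ j)) - ℓ n i (u (κ k))) ^ 2 := by
        simp_rw [hsub n _ _ _ (hu _).continuous (hu _).continuous]
        gcongr
    _ < ε := by linarith

omit [RiemannianBundle (fun x : M => TangentSpace (𝓡∂ d) x)] [IsManifold (𝓡∂ d) ∞ M]
  [IsContMDiffRiemannianBundle (𝓡∂ d) ∞ (EuclideanSpace ℝ (Fin d))
    (fun x : M => TangentSpace (𝓡∂ d) x)] [IsFiniteMeasure (weightedMeasure d f)]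
    [ChartedSpace (EuclideanHalfSpace d) M] in
theorem memLp_of_continuous {m : Measure M} [IsFiniteMeasure m] {h : M → ℝ}
    (hh : Continuous h) : MemLp h 2 m :=
  hh.memLp_of_hasCompactSupport (HasCompactSupport.of_compactSpace h)

theorem eLpNorm_two_sq_eq {α : Type*} [MeasurableSpace α] {m : Measure α} {h : α → ℝ}
    (hh : MemLp h 2 m) : eLpNorm h 2 m ^ 2 = ENNReal.ofReal (∫ y, h y ^ 2 ∂m) := by
  have h1 := eLpNorm_nnreal_pow_eq_lintegral (f := h) (μ := m) (p := 2) two_ne_zero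
  norm_num at h1
  rw [h1, ofReal_integral_eq_lintegral_ofReal hh.integrable_sq
    (Eventually.of_forall fun x => sq_nonneg _)]
  refine lintegral_congr fun x => ?_
  rw [← ofReal_norm, ← ENNReal.ofReal_pow (norm_nonneg _), Real.norm_eq_abs, sq_abs]

/-- Completeness of `L²`, for sequences of functions with small differences in the mean square. -/
theorem exists_tendsto_eLpNorm_of_cauchy {α : Type*} [MeasurableSpace α] {m : Measure α}
    {u : ℕ → α → ℝ} (hu : ∀ j, MemLp (u j) 2 m)
    (h : ∀ ε : ℝ, 0 < ε → ∃ N, ∀ j ≥ N, ∀ k ≥ N, ∫ y, (u j - u k) y ^ 2 ∂m < ε) :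
    ∃ φ : α → ℝ, MemLp φ 2 m ∧ Tendsto (fun j => eLpNorm (u j - φ) 2 m) atTop (𝓝 0) := by
  have hc : CauchySeq fun j => (hu j).toLp (u j) := by
    refine Metric.cauchySeq_iff.2 fun ε hε => ?_
    obtain ⟨N, hN⟩ := h (ε ^ 2) (by positivity)
    refine ⟨N, fun j hj k hk => ?_⟩
    rw [Lp.dist_def, eLpNorm_congr_ae ((hu j).coeFn_toLp.sub (hu k).coeFn_toLp)]
    have h1 := eLpNorm_two_sq_eq ((hu j).sub (hu k))
    refine lt_of_pow_lt_pow_left₀ 2 hε.le ?_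
    rw [← ENNReal.toReal_pow, h1, ENNReal.toReal_ofReal (integral_nonneg fun _ => sq_nonneg _)]
    exact hN j hj k hk
  obtain ⟨φ, hφ⟩ := cauchySeq_tendsto_of_complete hc
  refine ⟨φ, Lp.memLp φ, ?_⟩
  have h2 := (Lp.tendsto_Lp_iff_tendsto_eLpNorm' _ _).1 hφ
  refine h2.congr fun j => eLpNorm_congr_ae ?_
  exact (hu j).coeFn_toLp.sub (ae_eq_refl _)

theorem tendsto_integral_mul_of_tendsto_eLpNorm {α : Type*} [MeasurableSpace α] {m : Measure α}
    {u : ℕ → α → ℝ} (hu : ∀ j, MemLp (u j) 2 m) {φ ψ : α → ℝ} (hφ : MemLp φ 2 m)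
    (hψ : MemLp ψ 2 m) (h : Tendsto (fun j => eLpNorm (u j - φ) 2 m) atTop (𝓝 0)) :
    Tendsto (fun j => ∫ x, u j x * ψ x ∂m) atTop (𝓝 (∫ x, φ x * ψ x ∂m)) := by
  have h1 : Tendsto (fun j => (hu j).toLp (u j)) atTop (𝓝 (hφ.toLp φ)) :=
    (Lp.tendsto_Lp_iff_tendsto_eLpNorm'' _ hu _ hφ).2 h
  have h2 : ∀ {g : α → ℝ} (hg : MemLp g 2 m),
      inner ℝ (hψ.toLp ψ) (hg.toLp g) = ∫ x, g x * ψ x ∂m := by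
    intro g hg
    rw [L2.inner_def]
    refine integral_congr_ae ?_
    filter_upwards [hψ.coeFn_toLp, hg.coeFn_toLp] with x hx1 hx2
    rw [hx1, hx2]
    simp
  have h3 := (h1.inner (tendsto_const_nhds (x := hψ.toLp ψ)) :
    Tendsto (fun j => inner ℝ ((hu j).toLp (u j)) (hψ.toLp ψ)) atTop _)
  simp_rw [real_inner_comm (hψ.toLp ψ), h2] at h3
  exact h3

theorem integral_sq_add_smul {m : Measure M} [IsFiniteMeasure m] {u v : M → ℝ}
    (hu : Continuous u) (hv : Continuous v) (c : ℝ) :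
    ∫ y, (u + c • v) y ^ 2 ∂m =
      ∫ y, u y ^ 2 ∂m + 2 * c * ∫ y, u y * v y ∂m + c ^ 2 * ∫ y, v y ^ 2 ∂m := by
  have h1 : Integrable (fun y => u y ^ 2) m := integrable_of_continuous (hu.pow 2)
  have h2 : Integrable (fun y => 2 * c * (u y * v y)) m :=
    integrable_of_continuous (continuous_const.mul (hu.mul hv))
  have h3 : Integrable (fun y => c ^ 2 * v y ^ 2) m :=
    integrable_of_continuous (continuous_const.mul (hv.pow 2))
  have h12 : Integrable (fun y => u y ^ 2 + 2 * c * (u y * v y)) m := h1.add h2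
  rw [← integral_const_mul, ← integral_const_mul, ← integral_add h1 h2, ← integral_add h12 h3]
  refine integral_congr_ae (Eventually.of_forall fun y => ?_)
  simp only [Pi.add_apply, Pi.smul_apply, smul_eq_mul]
  ring

/-- A minimizing sequence for the Rayleigh quotient converges to a weak eigenfunction: its energies
are Cauchy by the parallelogram identity, and its first variation tends to zero by the
Cauchy-Schwarz inequality for the nonnegative form `E - μ ‖·‖²`. -/
theorem isDirichletEigenvalue_of_minimizing (hf : Continuous f) {μ : ℝ}
    (hμ : ∀ u, IsTestFunction d u →
      μ * ∫ y, u y ^ 2 ∂weightedMeasure d f ≤ dirichletForm d f u u)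
    {u : ℕ → M → ℝ} (hu : ∀ j, IsTestFunction d (u j))
    (hu1 : ∀ j, ∫ y, u j y ^ 2 ∂weightedMeasure d f = 1)
    (hE : Tendsto (fun j => dirichletForm d f (u j) (u j)) atTop (𝓝 μ)) :
    IsDirichletEigenvalue d f μ := by
  set m := weightedMeasure d f
  obtain ⟨B, hB⟩ := hE.bddAbove_range
  obtain ⟨κ, hκ, hcauchy⟩ := exists_subseq_cauchy hf (fun j => (hu j).contMDiff_one)
    (fun j => (hu1 j).le) (fun j => hB (Set.mem_range_self j))
  set v : ℕ → M → ℝ := fun j => u (κ j) with hvdef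
  have hv : ∀ j, IsTestFunction d (v j) := fun j => hu _
  have hvc : ∀ j, Continuous (v j) := fun j => (hv j).1.continuous
  have hv1 : ∀ j, ∫ y, v j y ^ 2 ∂m = 1 := fun j => hu1 _
  have hEv : Tendsto (fun j => dirichletForm d f (v j) (v j)) atTop (𝓝 μ) :=
    hE.comp hκ.tendsto_atTop
  have hμ0 : 0 ≤ μ := ge_of_tendsto' hE fun j => dirichletForm_self_nonneg
  have hmem : ∀ j, MemLp (v j) 2 m := fun j => memLp_of_continuous (hvc j)
  obtain ⟨φ, hφ, hlim⟩ := exists_tendsto_eLpNorm_of_cauchy hmem hcauchy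
  refine ⟨φ, v, ⟨hv, hφ, hlim, fun ε hε => ?_⟩, fun h0 => ?_, fun ψ hψ => ?_⟩
  · have hev : ∀ᶠ j in atTop, dirichletForm d f (v j) (v j) < μ + ε / 8 :=
      hEv.eventually_lt_const (by linarith)
    obtain ⟨N₁, hN₁⟩ := eventually_atTop.1 hev
    obtain ⟨N₂, hN₂⟩ := hcauchy (ε / (4 * (μ + 1))) (by positivity)
    refine ⟨max N₁ N₂, fun j hj k hk => ?_⟩
    have e1 := hN₁ j ((le_max_left _ _).trans hj)
    have e2 := hN₁ k ((le_max_left _ _).trans hk)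
    have e3 := hN₂ j ((le_max_right _ _).trans hj) k ((le_max_right _ _).trans hk)
    have e4 := hμ _ ((hv j).add (hv k))
    have e5 := dirichletForm_sub_self (f := f) (hv j).contMDiff_one (hv k).contMDiff_one
    have e6 := dirichletForm_add_self (f := f) (hv j).contMDiff_one (hv k).contMDiff_one
    have e7 := integral_sq_add_smul (m := m) (hvc j) (hvc k) 1
    have e8 := integral_sq_add_smul (m := m) (hvc j) (hvc k) (-1)
    rw [one_smul, hv1, hv1] at e7
    rw [neg_one_smul, ← sub_eq_add_neg, hv1, hv1] at e8
    change ∫ y, (v j - v k) y ^ 2 ∂m < _ at e3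
    have e9 : μ * ∫ y, (v j - v k) y ^ 2 ∂m ≤ ε / 4 := by
      calc μ * ∫ y, (v j - v k) y ^ 2 ∂m ≤ (μ + 1) * (ε / (4 * (μ + 1))) :=
            mul_le_mul (by linarith) e3.le (integral_nonneg fun _ => sq_nonneg _) (by positivity)
        _ = ε / 4 := by field_simp
    have e10 : ∫ y, (v j + v k) y ^ 2 ∂m = 4 - ∫ y, (v j - v k) y ^ 2 ∂m := by linarith
    rw [e10] at e4
    nlinarith
  · have h1 : Tendsto (fun j => eLpNorm (v j) 2 m) atTop (𝓝 0) := by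
      refine hlim.congr fun j => eLpNorm_congr_ae ?_
      filter_upwards [h0] with x hx
      simp [hx]
    have h2 : ∀ j, eLpNorm (v j) 2 m = 1 := fun j => by
      have h3 := eLpNorm_two_sq_eq (hmem j)
      rw [hv1, ENNReal.ofReal_one] at h3
      exact (ENNReal.pow_right_strictMono two_ne_zero).injective (h3.trans (one_pow 2).symm)
    simp_rw [h2] at h1
    exact one_ne_zero (tendsto_nhds_unique tendsto_const_nhds h1)
  · have hψc : Continuous ψ := hψ.1.continuous
    have h1 := (tendsto_integral_mul_of_tendsto_eLpNorm hmem hφ (memLp_of_continuous hψc)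
      hlim).const_mul μ
    set q : ℕ → ℝ := fun j => dirichletForm d f (v j) ψ - μ * ∫ x, v j x * ψ x ∂m
    set Q := dirichletForm d f ψ ψ - μ * ∫ x, ψ x ^ 2 ∂m
    have hq : ∀ j, q j ^ 2 ≤ Q * (dirichletForm d f (v j) (v j) - μ) := by
      intro j
      have h := discrim_le_zero (a := Q) (b := 2 * q j)
        (c := dirichletForm d f (v j) (v j) - μ) fun t => by
          have h2 := hμ _ ((hv j).add (hψ.smul t))
          rw [dirichletForm_add_smul (hv j).contMDiff_one hψ.contMDiff_one,
            integral_sq_add_smul (hvc j) hψc, hv1] at h2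
          simp only [q, Q]
          linarith
      rw [discrim] at h
      linarith
    have hq0 : Tendsto q atTop (𝓝 0) := by
      have h2 : Tendsto (fun j => Q * (dirichletForm d f (v j) (v j) - μ)) atTop (𝓝 0) := by
        have h3 := (hEv.sub_const μ).const_mul Q
        rwa [sub_self, mul_zero] at h3
      have h4 : Tendsto (fun j => q j ^ 2) atTop (𝓝 0) :=
        squeeze_zero (fun j => sq_nonneg _) hq h2
      have h5 := (Real.continuous_sqrt.tendsto 0).comp h4
      simp only [Real.sqrt_zero, Function.comp_def, Real.sqrt_sq_eq_abs] at h5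
      exact (tendsto_zero_iff_abs_tendsto_zero _).2 h5
    have h6 := hq0.add h1
    rw [zero_add] at h6
    exact h6.congr fun j => by simp [q]

/-- The weak equation is tested with the approximating functions `u k`; since
`2 E(u j, u k) ≥ -E(u j - u k)`, the limit in `j` and then in `k` gives `μ ∫ φ² ≥ 0`. -/
theorem IsDirichletEigenvalue.nonneg {μ : ℝ} (h : IsDirichletEigenvalue d f μ) : 0 ≤ μ := by
  obtain ⟨φ, u, hu, h0, hw⟩ := h
  set m := weightedMeasure d f
  have hmem : ∀ j, MemLp (u j) 2 m := fun j =>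
    memLp_of_continuous (hu.isTestFunction j).1.continuous
  have hlim := tendsto_integral_mul_of_tendsto_eLpNorm hmem hu.memLp hu.memLp hu.tendsto
  have hpos : 0 < ∫ x, φ x * φ x ∂m := by
    have hsq : ∀ x, φ x * φ x = φ x ^ 2 := fun x => (sq _).symm
    simp_rw [hsq]
    refine (integral_nonneg fun x => sq_nonneg _).lt_of_ne' fun h => h0 ?_
    have := (integral_eq_zero_iff_of_nonneg (fun x => sq_nonneg (φ x)) hu.memLp.integrable_sq).1 h
    filter_upwards [this] with x hx
    simpa using hx
  have hge : 0 ≤ μ * ∫ x, φ x * φ x ∂m := by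
    refine le_of_forall_pos_lt_add fun ε hε => ?_
    obtain ⟨N, hN⟩ := hu.cauchy ε hε
    have h1 : ∀ k ≥ N, -(ε / 2) ≤ μ * ∫ x, u k x * φ x ∂m := by
      intro k hk
      have h2 := hw (u k) (hu.isTestFunction k)
      simp_rw [mul_comm (φ _)] at h2
      refine ge_of_tendsto h2 (eventually_atTop.2 ⟨N, fun j hj => ?_⟩)
      have h3 := hN j hj k hk
      rw [dirichletForm_sub_self (hu.isTestFunction j).contMDiff_one
        (hu.isTestFunction k).contMDiff_one] at h3
      linarith [dirichletForm_self_nonneg (f := f) (d := d) (u := u j),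
        dirichletForm_self_nonneg (f := f) (d := d) (u := u k)]
    have h4 := ge_of_tendsto (hlim.const_mul μ) (eventually_atTop.2 ⟨N, h1⟩)
    linarith
  exact nonneg_of_mul_nonneg_left hge hpos

/-- The Poincaré inequality with the first Dirichlet eigenvalue as constant. The infimum of the
Rayleigh quotients is itself an eigenvalue, hence at least the least one. -/
theorem firstDirichletEigenvalue_mul_integral_sq_le (hf : Continuous f) {u : M → ℝ}
    (hu : IsTestFunction d u) :
    firstDirichletEigenvalue d f * ∫ y, u y ^ 2 ∂weightedMeasure d f ≤ dirichletForm d f u u := by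
  set m := weightedMeasure d f
  have hN : ∀ v : M → ℝ, 0 ≤ ∫ y, v y ^ 2 ∂m := fun v => integral_nonneg fun _ => sq_nonneg _
  rcases (hN u).eq_or_lt with h0 | h0
  · rw [← h0, mul_zero]
    exact dirichletForm_self_nonneg
  set S : Set ℝ := {r | ∃ v, IsTestFunction d v ∧ 0 < ∫ y, v y ^ 2 ∂m ∧
    r = dirichletForm d f v v / ∫ y, v y ^ 2 ∂m}
  have hbdd : BddBelow S := by
    refine ⟨0, ?_⟩
    rintro _ ⟨v, -, hv, rfl⟩
    exact div_nonneg dirichletForm_self_nonneg hv.le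
  have hne : S.Nonempty := ⟨_, u, hu, h0, rfl⟩
  have hinf : ∀ v, IsTestFunction d v → sInf S * ∫ y, v y ^ 2 ∂m ≤ dirichletForm d f v v := by
    intro v hv
    rcases (hN v).eq_or_lt with h1 | h1
    · rw [← h1, mul_zero]
      exact dirichletForm_self_nonneg
    · rw [← le_div_iff₀ h1]
      exact csInf_le hbdd ⟨v, hv, h1, rfl⟩
  obtain ⟨r, -, hr, hrS⟩ := exists_seq_tendsto_sInf hne hbdd
  choose v hv hv0 hrv using hrS
  have hnorm : ∀ j, (√(∫ y, v j y ^ 2 ∂m))⁻¹ ^ 2 = (∫ y, v j y ^ 2 ∂m)⁻¹ := fun j => by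
    rw [inv_pow, Real.sq_sqrt (hN _)]
  have heig : IsDirichletEigenvalue d f (sInf S) := by
    refine isDirichletEigenvalue_of_minimizing hf hinf
      (u := fun j => (√(∫ y, v j y ^ 2 ∂m))⁻¹ • v j) (fun j => (hv j).smul _) (fun j => ?_) ?_
    · simp only [Pi.smul_apply, smul_eq_mul, mul_pow, hnorm]
      rw [integral_const_mul]
      exact inv_mul_cancel₀ (hv0 j).ne'
    · refine hr.congr fun j => ?_
      rw [dirichletForm_smul_left (hv j).contMDiff_one, dirichletForm_comm,
        dirichletForm_smul_left (hv j).contMDiff_one, ← mul_assoc, ← sq, hnorm, hrv,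
        div_eq_inv_mul]
  refine le_trans ?_ (hinf u hu)
  -- `sInf` of the set of eigenvalues is meaningful, because they are bounded below by `0`
  exact mul_le_mul_of_nonneg_right (csInf_le ⟨0, fun μ hμ => hμ.nonneg⟩ heig) (hN u)

end Eigenvalue

/-! ### Mollification and distance in charts -/

section Mollification

open Metric Convolution

variable {E : Type*} [NormedAddCommGroup E] [NormedSpace ℝ E] [FiniteDimensional ℝ E]

/-- Mollification: a function that is Lipschitz on a ball with respect to a translation invariant
gauge `N` is approximated, uniformly on the concentric ball of half the radius, by smooth functions
that satisfy the same Lipschitz bound. -/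
theorem exists_contDiff_near_of_lipschitz {N : E → ℝ} {C : ℝ} (hC : 0 < C)
    (hN : ∀ v, N v ≤ C * ‖v‖) {g : E → ℝ} {a : E} {ρ : ℝ} (hρ : 0 < ρ)
    (hg : ∀ z ∈ ball a ρ, ∀ z' ∈ ball a ρ, |g z - g z'| ≤ N (z - z')) {δ : ℝ} (hδ : 0 < δ) :
    ∃ h : E → ℝ, ContDiff ℝ ∞ h ∧ (∀ z ∈ ball a (ρ / 2), |h z - g z| ≤ δ) ∧
      ∀ z ∈ ball a (ρ / 2), ∀ z' ∈ ball a (ρ / 2), |h z - h z'| ≤ N (z - z') := by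
  let _ : MeasurableSpace E := borel E
  have : BorelSpace E := ⟨rfl⟩
  let μ : Measure E := Measure.addHaar
  have hgC : ∀ z ∈ ball a ρ, ∀ z' ∈ ball a ρ, |g z - g z'| ≤ C * ‖z - z'‖ :=
    fun z hz z' hz' => (hg z hz z' hz').trans (hN _)
  set G : E → ℝ := (ball a ρ).indicator g with hGdef
  have hcont : ContinuousOn g (ball a ρ) := by
    refine (LipschitzOnWith.of_dist_le_mul (K := ⟨C, hC.le⟩) fun z hz z' hz' => ?_).continuousOn
    rw [Real.dist_eq, dist_eq_norm]
    exact hgC z hz z' hz'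
  have hGint : Integrable G μ := by
    rw [integrable_indicator_iff measurableSet_ball]
    refine IntegrableOn.of_bound measure_ball_lt_top
      (hcont.aestronglyMeasurable measurableSet_ball) (|g a| + C * ρ) ?_
    filter_upwards [ae_restrict_mem measurableSet_ball] with z hz
    have h1 := hgC z hz a (mem_ball_self hρ)
    have h2 : C * ‖z - a‖ ≤ C * ρ := by
      gcongr
      rw [← dist_eq_norm]
      exact (mem_ball.1 hz).le
    have h3 := abs_sub_abs_le_abs_sub (g z) (g a)
    rw [Real.norm_eq_abs]
    linarith
  set s := min (ρ / 2) (δ / C)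
  have hs : 0 < s := by positivity
  let β : ContDiffBump (0 : E) := ⟨s / 2, s, by positivity, by linarith⟩
  have hβ : β.rOut = s := rfl
  have hmem : ∀ z ∈ ball a (ρ / 2), ∀ t ∈ ball (0 : E) s, z - t ∈ ball a ρ := by
    intro z hz t ht
    rw [mem_ball, dist_eq_norm] at hz ⊢
    rw [mem_ball, dist_zero_right] at ht
    have h1 : ‖z - t - a‖ ≤ ‖z - a‖ + ‖t‖ := by
      rw [sub_right_comm]
      exact norm_sub_le _ _
    have h2 : s ≤ ρ / 2 := min_le_left _ _
    linarith
  have hhalf : ∀ z ∈ ball a (ρ / 2), z ∈ ball a ρ := fun z hz =>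
    ball_subset_ball (by linarith) hz
  have hex : ConvolutionExists (β.normed μ) G (ContinuousLinearMap.lsmul ℝ ℝ) μ :=
    β.hasCompactSupport_normed.convolutionExists_left _ β.continuous_normed
      hGint.locallyIntegrable
  refine ⟨β.normed μ ⋆[ContinuousLinearMap.lsmul ℝ ℝ, μ] G,
    β.hasCompactSupport_normed.contDiff_convolution_left _ β.contDiff_normed
      hGint.locallyIntegrable, fun z hz => ?_, fun z hz z' hz' => ?_⟩
  · have h1 : G z = g z := Set.indicator_of_mem (hhalf z hz) g
    rw [← h1, ← Real.dist_eq]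
    refine β.dist_normed_convolution_le hGint.aestronglyMeasurable fun y hy => ?_
    rw [hβ, mem_ball, dist_eq_norm] at hy
    have hyb : y ∈ ball a ρ := by
      have h2 := hmem z hz (z - y) (by rwa [mem_ball, dist_zero_right, norm_sub_rev])
      rwa [sub_sub_cancel] at h2
    rw [h1, hGdef, Set.indicator_of_mem hyb, Real.dist_eq]
    calc |g y - g z| ≤ C * ‖y - z‖ := hgC y hyb z (hhalf z hz)
      _ ≤ C * (δ / C) := by
        gcongr
        exact hy.le.trans (min_le_right _ _)
      _ = δ := by field_simp
  · have hpt : ∀ t, ‖β.normed μ t • G (z - t) - β.normed μ t • G (z' - t)‖ ≤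
        β.normed μ t * N (z - z') := by
      intro t
      by_cases ht : t ∈ ball (0 : E) s
      · have h1 := hg _ (hmem z hz t ht) _ (hmem z' hz' t ht)
        rw [sub_sub_sub_cancel_right] at h1
        rw [hGdef, Set.indicator_of_mem (hmem z hz t ht), Set.indicator_of_mem (hmem z' hz' t ht),
          ← smul_sub, norm_smul, Real.norm_of_nonneg (β.nonneg_normed t)]
        exact mul_le_mul_of_nonneg_left h1 (β.nonneg_normed t)
      · have h1 : β.normed μ t = 0 := by
          rw [← Function.notMem_support, β.support_normed_eq]
          exact ht
        simp [h1]
    have h1 : ∀ y, (β.normed μ ⋆[ContinuousLinearMap.lsmul ℝ ℝ, μ] G) y =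
        ∫ t, β.normed μ t • G (y - t) ∂μ := fun y => rfl
    have h2 : ∀ y, Integrable (fun t => β.normed μ t • G (y - t)) μ := fun y => hex y
    rw [h1, h1, ← integral_sub (h2 z) (h2 z'), ← Real.norm_eq_abs]
    refine (norm_integral_le_of_norm_le (β.integrable_normed.mul_const _)
      (Eventually.of_forall hpt)).trans_eq ?_
    rw [integral_mul_const, β.integral_normed, one_mul]

omit [FiniteDimensional ℝ E] in
theorem abs_fderiv_le_of_forall_le {h : E → ℝ} {N : E → ℝ}
    (hN : ∀ (c : ℝ) v, N (c • v) = |c| * N v) {z : E} (hz : DifferentiableAt ℝ h z)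
    (hlip : ∀ᶠ z' in 𝓝 z, |h z' - h z| ≤ N (z' - z)) (v : E) (hv : 0 ≤ N v) :
    |fderiv ℝ h z v| ≤ N v := by
  have hline : HasDerivAt (fun t : ℝ => z + t • v) v 0 := by
    simpa using ((hasDerivAt_id (0 : ℝ)).smul_const v).const_add z
  have h0 : HasFDerivAt h (fderiv ℝ h z) (z + (0 : ℝ) • v) := by simpa using hz.hasFDerivAt
  have h1 := h0.comp_hasDerivAt (0 : ℝ) hline
  refine h1.le_of_lip' hv ?_
  have h2 : Tendsto (fun t : ℝ => z + t • v) (𝓝 0) (𝓝 z) := by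
    simpa using hline.continuousAt.tendsto
  filter_upwards [h2.eventually hlip] with t ht
  simp only [Function.comp_apply, zero_smul, add_zero, sub_zero, Real.norm_eq_abs]
  rw [add_sub_cancel_left, hN] at ht
  linarith

end Mollification

section Distance

variable {d : ℕ} [NeZero d] {M : Type*} [MetricSpace M]
  [ChartedSpace (EuclideanHalfSpace d) M] [IsManifold (𝓡∂ d) ∞ M]
  [RiemannianBundle (fun x : M => TangentSpace (𝓡∂ d) x)]
  [IsRiemannianManifold (𝓡∂ d) M]

/-- In a chart, the Riemannian distance is at most the length of the straight segment. -/
theorem edist_extChartAt_symm_le {x : M} {s : Set (EuclideanSpace ℝ (Fin d))} (hs : Convex ℝ s)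
    (hst : s ⊆ (extChartAt (𝓡∂ d) x).target) {r : ℝ}
    (hr : ∀ z ∈ s, ∀ w, tangentNorm ((extChartAt (𝓡∂ d) x).symm z) (chartDeriv d x z w) ≤
      r * tangentNorm x w) {z z' : EuclideanSpace ℝ (Fin d)} (hz : z ∈ s) (hz' : z' ∈ s) :
    edist ((extChartAt (𝓡∂ d) x).symm z) ((extChartAt (𝓡∂ d) x).symm z') ≤
      ENNReal.ofReal (r * tangentNorm x (z' - z)) := by
  let η : ℝ → EuclideanSpace ℝ (Fin d) := AffineMap.lineMap z z'
  have hη : ∀ t ∈ Set.Icc (0 : ℝ) 1, η t ∈ s := fun t ht => hs.lineMap_mem hz hz' ht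
  have hηd : ∀ t, HasDerivAt η (z' - z) t := fun t => AffineMap.hasDerivAt_lineMap
  have hηs : ContMDiffOn 𝓘(ℝ, ℝ) 𝓘(ℝ, EuclideanSpace ℝ (Fin d)) 1 η (Set.Icc 0 1) := by
    rw [contMDiffOn_iff_contDiffOn]
    exact (ContinuousAffineMap.contDiff (ContinuousAffineMap.lineMap (R := ℝ) z z')).contDiffOn
  rw [IsRiemannianManifold.out (I := 𝓡∂ d)]
  refine (Manifold.riemannianEDist_le_pathELength
    (γ := (extChartAt (𝓡∂ d) x).symm ∘ η) (a := 0) (b := 1)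
    (((contMDiffOn_extChartAt_symm (n := ∞) x).of_le (by simp)).comp hηs
      fun t ht => hst (hη t ht)) (by simp [η]) (by simp [η]) zero_le_one).trans ?_
  rw [Manifold.pathELength_eq_lintegral_mfderivWithin_Icc]
  have hconst : ENNReal.ofReal (r * tangentNorm x (z' - z)) =
      ∫⁻ _ in Set.Icc (0 : ℝ) 1, ENNReal.ofReal (r * tangentNorm x (z' - z)) := by simp
  rw [hconst]
  refine setLIntegral_mono' measurableSet_Icc fun t ht => ?_
  have hcomp : mfderivWithin 𝓘(ℝ, ℝ) (𝓡∂ d) ((extChartAt (𝓡∂ d) x).symm ∘ η)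
      (Set.Icc 0 1) t 1 = chartDeriv d x (η t) (z' - z) := by
    have h1 := ((mdifferentiableWithinAt_extChartAt_symm (I := 𝓡∂ d)
      (hst (hη t ht))).hasMFDerivWithinAt.comp t
      (hηd t).hasFDerivAt.hasFDerivWithinAt.hasMFDerivWithinAt
      fun t ht => extChartAt_target_subset_range x (hst (hη t ht))).mfderivWithin
      ((uniqueMDiffWithinAt_iff_uniqueDiffWithinAt).2 (uniqueDiffOn_Icc zero_lt_one t ht))
    rw [h1]
    refine congrArg (chartDeriv d x (η t)) ?_
    exact one_smul ℝ (z' - z)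
  rw [hcomp]
  refine (ofReal_norm (E := TangentSpace (𝓡∂ d) ((extChartAt (𝓡∂ d) x).symm (η t)))
    (chartDeriv d x (η t) (z' - z))).symm.trans_le ?_
  exact ENNReal.ofReal_le_ofReal (hr _ (hη t ht) _)

end Distance

/-! ### Approximation of Lipschitz functions by test functions -/

section Leibniz

variable {d : ℕ} [NeZero d] {M : Type*} [TopologicalSpace M]
  [ChartedSpace (EuclideanHalfSpace d) M]

theorem differential_mul {φ ψ : M → ℝ} {p : M} (hφ : MDifferentiableAt (𝓡∂ d) 𝓘(ℝ, ℝ) φ p)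
    (hψ : MDifferentiableAt (𝓡∂ d) 𝓘(ℝ, ℝ) ψ p) :
    differential d (φ * ψ) p = φ p • differential d ψ p + ψ p • differential d φ p :=
  (hφ.hasMFDerivAt.mul hψ.hasMFDerivAt).mfderiv

theorem differential_const (c : ℝ) (p : M) : differential d (fun _ => c) p = 0 :=
  mfderiv_const

theorem differential_eq_zero_of_notMem_tsupport {φ : M → ℝ} {p : M} (hp : p ∉ tsupport φ) :
    differential d φ p = 0 := by
  have h : φ =ᶠ[𝓝 p] fun _ => 0 := notMem_tsupport_iff_eventuallyEq.1 hp
  exact h.mfderiv_eq.trans mfderiv_const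

theorem mdifferentiableAt_and_differential_sum {ι : Type*} (s : Finset ι) {φ : ι → M → ℝ} {p : M}
    (hφ : ∀ i ∈ s, MDifferentiableAt (𝓡∂ d) 𝓘(ℝ, ℝ) (φ i) p) :
    MDifferentiableAt (𝓡∂ d) 𝓘(ℝ, ℝ) (∑ i ∈ s, φ i) p ∧
      differential d (∑ i ∈ s, φ i) p = ∑ i ∈ s, differential d (φ i) p := by
  classical
  induction s using Finset.induction_on with
  | empty =>
    rw [Finset.sum_empty, Finset.sum_empty]
    exact ⟨mdifferentiableAt_const, differential_const 0 p⟩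
  | insert i s hi ih =>
    obtain ⟨h1, h2⟩ := ih fun j hj => hφ j (Finset.mem_insert_of_mem hj)
    have h3 := hφ i (Finset.mem_insert_self i s)
    rw [Finset.sum_insert hi, Finset.sum_insert hi, ← h2]
    exact ⟨h3.add h1, differential_add h3 h1⟩

variable [RiemannianBundle (fun x : M => TangentSpace (𝓡∂ d) x)]

theorem cotangentNorm_sum_le {ι : Type*} (p : M) (s : Finset ι)
    (α : ι → EuclideanSpace ℝ (Fin d) →L[ℝ] ℝ) :
    cotangentNorm p (∑ i ∈ s, α i) ≤ ∑ i ∈ s, cotangentNorm p (α i) :=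
  norm_sum_le (E := TangentSpace (𝓡∂ d) p →L[ℝ] ℝ) s α

end Leibniz

section Approximation

variable {d : ℕ} [NeZero d] {M : Type*} [MetricSpace M]
  [ChartedSpace (EuclideanHalfSpace d) M] [IsManifold (𝓡∂ d) ∞ M]
  [RiemannianBundle (fun x : M => TangentSpace (𝓡∂ d) x)]
  [IsContMDiffRiemannianBundle (𝓡∂ d) ∞ (EuclideanSpace ℝ (Fin d))
    (fun x : M => TangentSpace (𝓡∂ d) x)]
  [IsRiemannianManifold (𝓡∂ d) M]

/-- Near an interior point, a `1`-Lipschitz function is uniformly approximated by smooth functions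
whose gradients have norm at most `r ^ 2`. One factor `r` bounds the distance by the norm of the
tangent space at `x`, the other one compares this norm with that of the neighbouring tangent
spaces. -/
theorem exists_local_contMDiffOn_near {w : M → ℝ} (hw : LipschitzWith 1 w) {x : M}
    (hx : x ∈ (𝓡∂ d).interior M) {r : ℝ} (hr : 1 < r) :
    ∃ V : Set M, IsOpen V ∧ x ∈ V ∧ ∀ δ : ℝ, 0 < δ → ∃ h : M → ℝ,
      ContMDiffOn (𝓡∂ d) 𝓘(ℝ, ℝ) ∞ h V ∧
      ∀ y ∈ V, |h y - w y| ≤ δ ∧ normGrad d h y ≤ r ^ 2 := by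
  set e := extChartAt (𝓡∂ d) x with he
  have hr0 : 0 ≤ r := by linarith
  have hrange : Set.range (𝓡∂ d) ∈ 𝓝 (e x) := range_mem_nhds_isInteriorPoint hx
  have hcmp := eventually_tangentNorm_chartDeriv (d := d) x hr
  have htgt := extChartAt_target_mem_nhdsWithin (I := 𝓡∂ d) x
  rw [nhdsWithin_eq_nhds.2 hrange] at hcmp htgt
  obtain ⟨ρ, hρ, hball⟩ := Metric.mem_nhds_iff.1 (inter_mem hcmp htgt)
  have hbt : Metric.ball (e x) ρ ⊆ e.target := fun z hz => (hball hz).2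
  have hhalf : Metric.ball (e x) (ρ / 2) ⊆ Metric.ball (e x) ρ :=
    Metric.ball_subset_ball (by linarith)
  have hlip : ∀ z ∈ Metric.ball (e x) ρ, ∀ z' ∈ Metric.ball (e x) ρ,
      |(w ∘ e.symm) z - (w ∘ e.symm) z'| ≤ r * tangentNorm x (z - z') := by
    intro z hz z' hz'
    have h1 := edist_extChartAt_symm_le (convex_ball (e x) ρ) hbt
      (fun z hz w => ((hball hz).1 w).1) hz' hz
    have h2 := (hw (e.symm z') (e.symm z)).trans ((one_mul _).trans_le h1)
    rw [edist_comm, edist_dist, Real.dist_eq] at h2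
    exact (ENNReal.ofReal_le_ofReal_iff (mul_nonneg hr0 (tangentNorm_nonneg _ _))).1 h2
  obtain ⟨C, hC, hCle⟩ := exists_tangentNorm_le (d := d) x
  refine ⟨e.source ∩ e ⁻¹' Metric.ball (e x) (ρ / 2),
    isOpen_extChartAt_preimage' x Metric.isOpen_ball,
    ⟨mem_extChartAt_source x, Metric.mem_ball_self (by positivity)⟩, fun δ hδ => ?_⟩
  obtain ⟨H, hH, hHδ, hHlip⟩ := exists_contDiff_near_of_lipschitz
    (N := fun v => r * tangentNorm x v) (C := r * C) (by positivity)
    (fun v => by rw [mul_assoc]; exact mul_le_mul_of_nonneg_left (hCle v) hr0) hρ hlip hδ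
  have hsmooth : ContMDiffOn (𝓡∂ d) 𝓘(ℝ, ℝ) ∞ (H ∘ e)
      (e.source ∩ e ⁻¹' Metric.ball (e x) (ρ / 2)) := by
    refine hH.contMDiff.comp_contMDiffOn ((contMDiffOn_extChartAt (I := 𝓡∂ d)).mono ?_)
    rw [he, extChartAt_source]
    exact Set.inter_subset_left
  refine ⟨H ∘ e, hsmooth, fun y hy => ⟨?_, ?_⟩⟩
  · have h1 := hHδ (e y) hy.2
    rwa [Function.comp_apply, e.left_inv hy.1] at h1
  have hz : e y ∈ Metric.ball (e x) ρ := hhalf hy.2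
  have hymd : MDifferentiableAt (𝓡∂ d) 𝓘(ℝ, ℝ) (H ∘ e) (e.symm (e y)) := by
    rw [e.left_inv hy.1]
    exact ((hsmooth y hy).contMDiffAt ((isOpen_extChartAt_preimage' x
      Metric.isOpen_ball).mem_nhds hy)).mdifferentiableAt (by simp)
  have hd : (differential d (H ∘ e) y).comp (chartDeriv d x (e y)) = fderiv ℝ H (e y) := by
    have h1 := (hasFDerivWithinAt_comp_extChartAt_symm (hbt hz) hymd).hasFDerivAt
      (mem_of_superset (Metric.isOpen_ball.mem_nhds hz)
        (hbt.trans (extChartAt_target_subset_range x)))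
    have h2 : (H ∘ e) ∘ e.symm =ᶠ[𝓝 (e y)] H := by
      filter_upwards [Metric.isOpen_ball.mem_nhds hz] with z hz
      simp only [Function.comp_apply, e.right_inv (hbt hz)]
    have h3 := (h1.congr_of_eventuallyEq h2.symm).fderiv
    rw [h3, e.left_inv hy.1]
  rw [normGrad_eq]
  refine cotangentNorm_le y _ (by positivity) fun v => ?_
  obtain ⟨v, rfl⟩ := exists_chartDeriv_eq (hbt hz) v
  have h1 : |fderiv ℝ H (e y) v| ≤ r * tangentNorm x v := by
    refine abs_fderiv_le_of_forall_le (N := fun v => r * tangentNorm x v)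
      (fun c v => by rw [tangentNorm_smul]; ring) (hH.differentiable (by simp) _) ?_ v
      (mul_nonneg hr0 (tangentNorm_nonneg _ _))
    filter_upwards [Metric.isOpen_ball.mem_nhds hy.2] with z hz
    exact hHlip z hz _ hy.2
  have h2 := ((hball hz).1 v).2
  rw [e.left_inv hy.1] at h2
  rw [← hd] at h1
  calc |differential d (H ∘ e) y (chartDeriv d x (e y) v)| ≤ r * tangentNorm x v := h1
    _ ≤ r * (r * tangentNorm y (chartDeriv d x (e y) v)) := mul_le_mul_of_nonneg_left h2 hr0
    _ = _ := by ring

variable [CompactSpace M]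

/-- A `1`-Lipschitz function with support in the interior is uniformly approximated by test
functions whose gradients have norm at most `C`, for any `C > 1`. Local approximations `h i` are
glued by a partition of unity `χ i`; as `∑ i, ∇(χ i) = 0`, the gradient of `∑ i, χ i * h i` is
`∑ i, χ i • ∇(h i) + ∑ i, (h i - w) • ∇(χ i)`, and the second sum is small. -/
theorem exists_isTestFunction_near {w : M → ℝ} (hw : LipschitzWith 1 w)
    (hsupp : tsupport w ⊆ (𝓡∂ d).interior M) {ε : ℝ} (hε : 0 < ε) {C : ℝ} (hC : 1 < C) :
    ∃ u : M → ℝ, IsTestFunction d u ∧ (∀ y, |u y - w y| ≤ ε) ∧ ∀ y, normGrad d u y ≤ C := by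
  obtain ⟨r, hr, hrC⟩ : ∃ r : ℝ, 1 < r ∧ r ^ 2 < C := by
    have h1 : Tendsto (fun r : ℝ => r ^ 2) (𝓝[>] 1) (𝓝 (1 ^ 2)) :=
      ((continuous_pow 2).tendsto 1).mono_left nhdsWithin_le_nhds
    rw [one_pow] at h1
    obtain ⟨r, hr, hr1⟩ := ((h1.eventually_lt_const hC).and self_mem_nhdsWithin).exists
    exact ⟨r, hr1, hr⟩
  have hint : IsOpen ((𝓡∂ d).interior M) :=
    ModelWithCorners.isOpen_interior (I := 𝓡∂ d) (M := M) (n := ∞) (by simp)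
  obtain ⟨O, hO, hwO, hOint⟩ := normal_exists_closure_subset (isClosed_tsupport w) hint hsupp
  have hloc : ∀ x : M, ∃ V : Set M, IsOpen V ∧ x ∈ V ∧ ∀ δ : ℝ, 0 < δ → ∃ h : M → ℝ,
      ContMDiffOn (𝓡∂ d) 𝓘(ℝ, ℝ) ∞ h V ∧
      (∀ y ∈ V, |h y - w y| ≤ δ ∧ normGrad d h y ≤ r ^ 2) ∧ ∀ y ∈ V, y ∉ O → h y = 0 := by
    intro x
    by_cases hx : x ∈ tsupport w
    · obtain ⟨V, hV, hxV, h⟩ := exists_local_contMDiffOn_near hw (hsupp hx) hr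
      refine ⟨V ∩ O, hV.inter hO, ⟨hxV, hwO hx⟩, fun δ hδ => ?_⟩
      obtain ⟨g, hg, hg'⟩ := h δ hδ
      exact ⟨g, hg.mono Set.inter_subset_left, fun y hy => hg' y hy.1,
        fun y hy hyO => absurd hy.2 hyO⟩
    · refine ⟨(tsupport w)ᶜ, (isClosed_tsupport w).isOpen_compl, hx, fun δ hδ =>
        ⟨fun _ => 0, contMDiffOn_const, fun y hy => ⟨?_, ?_⟩, fun _ _ _ => rfl⟩⟩
      · rw [image_eq_zero_of_notMem_tsupport hy]
        simpa using hδ.le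
      · rw [normGrad_eq, differential_const]
        exact cotangentNorm_le _ _ (by positivity) fun v => by
          simpa using mul_nonneg (sq_nonneg r) (tangentNorm_nonneg y v)
  choose V hVo hxV hV using hloc
  obtain ⟨t, ht⟩ := isCompact_univ.elim_finite_subcover V hVo
    fun x _ => Set.mem_iUnion.2 ⟨x, hxV x⟩
  obtain ⟨χ, hχ⟩ := SmoothPartitionOfUnity.exists_isSubordinate (𝓡∂ d) isClosed_univ
    (fun i : t => V i) (fun i => hVo i) (fun y hy => by
      obtain ⟨i, hi, hyi⟩ := Set.mem_iUnion₂.1 (ht hy)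
      exact Set.mem_iUnion.2 ⟨⟨i, hi⟩, hyi⟩)
  have hχ1 : ∀ i, ContMDiff (𝓡∂ d) 𝓘(ℝ, ℝ) 1 (χ i) := fun i => (χ i).contMDiff.of_le (by simp)
  have hχsum : ∀ y, ∑ i, χ i y = 1 := fun y => by
    rw [← finsum_eq_sum_of_fintype]
    exact χ.sum_eq_one (Set.mem_univ y)
  obtain ⟨B, hB⟩ : ∃ B : ℝ, ∀ y, ∑ i, normGrad d (χ i) y ≤ B := by
    have h1 : Continuous fun y => ∑ i, normGrad d (χ i) y :=
      continuous_finsetSum _ fun i _ => continuous_normGrad (hχ1 i)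
    obtain ⟨B, hB⟩ := (isCompact_range h1).bddAbove
    exact ⟨B, fun y => hB (Set.mem_range_self y)⟩
  set δ := min ε ((C - r ^ 2) / (|B| + 1)) with hδdef
  have hδ : 0 < δ := lt_min hε (div_pos (by linarith) (by positivity))
  choose h hhs hh hhO using fun i : t => hV i δ hδ
  have hmem : ∀ i y, y ∈ tsupport (χ i) → y ∈ V i := fun i y hy => hχ i hy
  have hmem' : ∀ i y, χ i y ≠ 0 → y ∈ V i := fun i y hy => hmem i y (subset_tsupport _ hy)
  set u : M → ℝ := ∑ i, ⇑(χ i) * h i with hudef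
  have hu : ∀ y, u y = ∑ i, χ i y * h i y := fun y => by
    rw [hudef, Finset.sum_apply]
    rfl
  have hsmooth : ContMDiff (𝓡∂ d) 𝓘(ℝ, ℝ) ∞ u := by
    have h1 := hχ.contMDiff_finsum_smul (n := ⊤) (fun i => hVo i) hhs
    refine h1.congr fun y => ?_
    rw [hu, finsum_eq_sum_of_fintype]
    rfl
  have hdiff : ∀ y, u y - w y = ∑ i, χ i y * (h i y - w y) := fun y => by
    simp_rw [mul_sub]
    rw [Finset.sum_sub_distrib, ← Finset.sum_mul, hχsum, one_mul, hu]
  have hterm : ∀ i y, MDifferentiableAt (𝓡∂ d) 𝓘(ℝ, ℝ) (⇑(χ i) * h i) y ∧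
      differential d (⇑(χ i) * h i) y =
        χ i y • differential d (h i) y + h i y • differential d (χ i) y := by
    intro i y
    by_cases hy : y ∈ tsupport (χ i)
    · have h1 := (hχ1 i).mdifferentiable one_ne_zero y
      have h2 := ((hhs i).contMDiffAt ((hVo i).mem_nhds (hmem i y hy))).mdifferentiableAt
        (by simp : (∞ : ℕ∞ω) ≠ 0)
      exact ⟨h1.mul h2, differential_mul h1 h2⟩
    -- outside the support of `χ i` all terms vanish, although `h i` need not be differentiable
    · have h1 : y ∉ tsupport (⇑(χ i) * h i) := fun h' => hy (tsupport_mul_subset_left h')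
      rw [differential_eq_zero_of_notMem_tsupport h1, differential_eq_zero_of_notMem_tsupport hy,
        image_eq_zero_of_notMem_tsupport hy, zero_smul, smul_zero, add_zero]
      refine ⟨?_, rfl⟩
      have h2 : ⇑(χ i) * h i =ᶠ[𝓝 y] fun _ => 0 := notMem_tsupport_iff_eventuallyEq.1 h1
      exact mdifferentiableAt_const.congr_of_eventuallyEq h2
  have hχd : ∀ y, ∑ i, differential d (χ i) y = 0 := by
    intro y
    have h1 := (mdifferentiableAt_and_differential_sum Finset.univ
      fun i _ => (hχ1 i).mdifferentiable one_ne_zero y).2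
    have h2 : ∑ i, ⇑(χ i) = fun _ => (1 : ℝ) := by
      funext y
      rw [Finset.sum_apply, hχsum]
    rw [← h1, h2, differential_const]
  have hdu : ∀ y, differential d u y = ∑ i, (χ i y • differential d (h i) y +
      (h i y - w y) • differential d (χ i) y) := by
    intro y
    rw [(mdifferentiableAt_and_differential_sum Finset.univ fun i _ => (hterm i y).1).2,
      Finset.sum_congr rfl fun i _ => (hterm i y).2]
    have hsub : ∀ i, (h i y - w y) • differential d (χ i) y =
        h i y • differential d (χ i) y - w y • differential d (χ i) y :=
      fun i => by
        ext v
        exact sub_mul _ _ _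
    rw [Finset.sum_add_distrib, Finset.sum_add_distrib, Finset.sum_congr rfl fun i _ => hsub i,
      Finset.sum_sub_distrib, ← Finset.smul_sum (r := w y), hχd, smul_zero, sub_zero]
  refine ⟨u, ⟨hsmooth, HasCompactSupport.of_compactSpace u, ?_⟩, fun y => ?_, fun y => ?_⟩
  · refine (closure_mono fun y hy => ?_).trans hOint
    by_contra hyO
    refine hy ?_
    rw [hu]
    refine Finset.sum_eq_zero fun i _ => ?_
    by_cases hi : χ i y = 0
    · rw [hi, zero_mul]
    · rw [hhO i y (hmem' i y hi) hyO, mul_zero]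
  · rw [hdiff]
    calc |∑ i, χ i y * (h i y - w y)| ≤ ∑ i, |χ i y * (h i y - w y)| :=
          Finset.abs_sum_le_sum_abs _ _
      _ ≤ ∑ i, χ i y * ε := by
        refine Finset.sum_le_sum fun i _ => ?_
        rw [abs_mul, abs_of_nonneg (χ.nonneg i y)]
        by_cases hi : χ i y = 0
        · rw [hi, zero_mul, zero_mul]
        · exact mul_le_mul_of_nonneg_left
            ((hh i y (hmem' i y hi)).1.trans (min_le_left _ _)) (χ.nonneg i y)
      _ = ε := by rw [← Finset.sum_mul, hχsum, one_mul]
  · rw [normGrad_eq, hdu]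
    have hi : ∀ i, cotangentNorm y (χ i y • differential d (h i) y +
        (h i y - w y) • differential d (χ i) y) ≤
          χ i y * r ^ 2 + δ * normGrad d (χ i) y := by
      intro i
      refine (cotangentNorm_add_le _ _ _).trans (add_le_add ?_ ?_)
      · refine (cotangentNorm_smul_le _ _ _).trans ?_
        rw [abs_of_nonneg (χ.nonneg i y), ← normGrad_eq]
        by_cases hi : χ i y = 0
        · rw [hi, zero_mul, zero_mul]
        · exact mul_le_mul_of_nonneg_left (hh i y (hmem' i y hi)).2 (χ.nonneg i y)
      · refine (cotangentNorm_smul_le _ _ _).trans ?_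
        rw [← normGrad_eq]
        by_cases hi : y ∈ tsupport (χ i)
        · exact mul_le_mul_of_nonneg_right (hh i y (hmem i y hi)).1 (normGrad_nonneg _ _)
        · have h0 : normGrad d (χ i) y = 0 := by
            rw [normGrad_eq, differential_eq_zero_of_notMem_tsupport hi]
            exact le_antisymm (cotangentNorm_le _ _ le_rfl fun v => by simp)
              (cotangentNorm_nonneg _ _)
          rw [h0, mul_zero, mul_zero]
    calc cotangentNorm y (∑ i, (χ i y • differential d (h i) y +
          (h i y - w y) • differential d (χ i) y))
        ≤ ∑ i, (χ i y * r ^ 2 + δ * normGrad d (χ i) y) :=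
          (cotangentNorm_sum_le _ _ _).trans (Finset.sum_le_sum fun i _ => hi i)
      _ = r ^ 2 + δ * ∑ i, normGrad d (χ i) y := by
        rw [Finset.sum_add_distrib, ← Finset.sum_mul, hχsum, one_mul, Finset.mul_sum]
      _ ≤ r ^ 2 + (C - r ^ 2) / (|B| + 1) * (|B| + 1) := by
        have h1 : ∑ i, normGrad d (χ i) y ≤ |B| + 1 := by linarith [hB y, le_abs_self B]
        have h2 : δ ≤ (C - r ^ 2) / (|B| + 1) := min_le_right _ _
        gcongr
        exact Finset.sum_nonneg fun i _ => normGrad_nonneg _ _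
      _ = C := by field_simp; ring

end Approximation

/-! ### The observable inscribed radius -/

theorem inRad_Iic_le (s : ℝ≥0) : inRad ({0} : Set ℝ≥0) (Set.Iic s) ≤ s := by
  refine iSup₂_le fun t ht => ?_
  rw [Metric.infEDist_singleton, edist_nndist, NNReal.nndist_zero_eq_val']
  exact ENNReal.coe_le_coe.2 ht

section Bound

variable {d : ℕ} [NeZero d] {M : Type*} [MetricSpace M]
  [ChartedSpace (EuclideanHalfSpace d) M] [IsManifold (𝓡∂ d) ∞ M]
  [RiemannianBundle (fun x : M => TangentSpace (𝓡∂ d) x)]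
  [IsContMDiffRiemannianBundle (𝓡∂ d) ∞ (EuclideanSpace ℝ (Fin d))
    (fun x : M => TangentSpace (𝓡∂ d) x)]
  [IsRiemannianManifold (𝓡∂ d) M] [CompactSpace M] [MeasurableSpace M] [BorelSpace M]
  {f : M → ℝ} [IsProbabilityMeasure (weightedMeasure d f)]

/-- Chebyshev's inequality for a test function close to `max (φ - s / 4) 0`, combined with the
Poincaré inequality. -/
theorem firstDirichletEigenvalue_mul_measureReal_le (hf : Continuous f) {φ : M → ℝ≥0}
    (hφ : LipschitzWith 1 φ) (hφ0 : ∀ x ∈ (𝓡∂ d).boundary M, φ x = 0) {s : ℝ≥0} (hs : 0 < s)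
    (hν : 0 ≤ firstDirichletEigenvalue d f) :
    firstDirichletEigenvalue d f * ((s : ℝ) ^ 2 / 4 *
      (weightedMeasure d f).real {x | s < φ x}) ≤ 4 := by
  set m := weightedMeasure d f
  have hs0 : (0 : ℝ) < s := hs
  set w : M → ℝ := fun x => max ((φ x : ℝ) - s / 4) 0 with hwdef
  have hφR : LipschitzWith 1 fun x => (φ x : ℝ) - s / 4 := by
    refine LipschitzWith.of_dist_le_mul fun x y => ?_
    rw [dist_sub_right]
    exact hφ.dist_le_mul x y
  have hw : LipschitzWith 1 w := hφR.max_const 0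
  have hsupp : tsupport w ⊆ (𝓡∂ d).interior M := by
    have hcl : IsClosed {x | (s : ℝ) / 4 ≤ φ x} :=
      isClosed_le continuous_const (NNReal.continuous_coe.comp hφ.continuous)
    have h1 : tsupport w ⊆ {x | (s : ℝ) / 4 ≤ φ x} := by
      refine closure_minimal (fun x hx => ?_) hcl
      rw [Set.mem_ofPred_eq]
      by_contra h
      exact hx (max_eq_right (by linarith [not_le.1 h]))
    refine h1.trans fun x hx => ?_
    rw [← ModelWithCorners.compl_boundary]
    intro hxb
    have h2 : (s : ℝ) / 4 ≤ φ x := hx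
    rw [hφ0 x hxb, NNReal.coe_zero] at h2
    linarith
  obtain ⟨u, hu, huw, hgrad⟩ := exists_isTestFunction_near hw hsupp
    (by positivity : (0 : ℝ) < s / 4) one_lt_two
  have hE : dirichletForm d f u u ≤ 4 := by
    rw [dirichletForm_self]
    calc ∫ x, normGrad d u x ^ 2 ∂m ≤ ∫ _, (4 : ℝ) ∂m := by
          refine integral_mono
            (integrable_of_continuous ((continuous_normGrad hu.contMDiff_one).pow 2))
            (integrable_const _) fun x => ?_
          have h1 := hgrad x
          have h2 := normGrad_nonneg (d := d) u x
          simp only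
          nlinarith
      _ = 4 := by simp
  have hmarkov : (s : ℝ) ^ 2 / 4 * m.real {x | s < φ x} ≤ ∫ x, u x ^ 2 ∂m := by
    refine le_trans ?_ (mul_meas_ge_le_integral_of_nonneg
      (Eventually.of_forall fun x => sq_nonneg (u x))
      (integrable_of_continuous (hu.1.continuous.pow 2)) ((s : ℝ) ^ 2 / 4))
    refine mul_le_mul_of_nonneg_left (measureReal_mono fun x hx => ?_) (by positivity)
    have h1 : (s : ℝ) < φ x := NNReal.coe_lt_coe.2 hx
    have h2 : (φ x : ℝ) - s / 4 ≤ w x := le_max_left _ _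
    have h3 := (abs_le.1 (huw x)).1
    have h4 : (s : ℝ) / 2 ≤ u x := by linarith
    have h5 : (s : ℝ) ^ 2 / 4 ≤ u x ^ 2 := by nlinarith
    exact h5
  calc _ ≤ firstDirichletEigenvalue d f * ∫ x, u x ^ 2 ∂m :=
        mul_le_mul_of_nonneg_left hmarkov hν
    _ ≤ 4 := (firstDirichletEigenvalue_mul_integral_sq_le hf hu).trans hE

/-- The set `[0, s]` has measure at least `1 - η` once the eigenvalue exceeds `16 / (s² η)`: the energy
is at most `4` and Chebyshev's inequality is applied at the level `s² / 4`. -/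
theorem obsInRad_le_of_le_firstDirichletEigenvalue (hf : Continuous f) {s : ℝ≥0} (hs : 0 < s)
    {η : ℝ} (hη : 0 < η) (hν : 16 / ((s : ℝ) ^ 2 * η) ≤ firstDirichletEigenvalue d f) :
    obsInRad ((𝓡∂ d).boundary M) (weightedMeasure d f) η ≤ s := by
  refine iSup_le fun φ => iSup₂_le fun hφ hφ0 => ?_
  refine le_trans (iInf_le_of_le (Set.Iic s) (iInf₂_le measurableSet_Iic ?_)) (inRad_Iic_le s)
  set m := weightedMeasure d f
  have hs0 : (0 : ℝ) < s := hs
  have hpos : 0 < 16 / ((s : ℝ) ^ 2 * η) := by positivity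
  have hφm : Measurable φ := hφ.continuous.measurable
  have htail : m.real {x | s < φ x} ≤ η := by
    have h1 := firstDirichletEigenvalue_mul_measureReal_le hf hφ hφ0 hs (hpos.le.trans hν)
    have h2 : 16 / ((s : ℝ) ^ 2 * η) * ((s : ℝ) ^ 2 / 4 * m.real {x | s < φ x}) ≤ 4 :=
      (mul_le_mul_of_nonneg_right hν (by positivity)).trans h1
    have h3 : 16 / ((s : ℝ) ^ 2 * η) * ((s : ℝ) ^ 2 / 4 * m.real {x | s < φ x}) =
        4 * (m.real {x | s < φ x} / η) := by
      field_simp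
      ring
    rw [h3] at h2
    rw [← div_le_one hη]
    linarith
  rw [Measure.map_apply hφm measurableSet_Iic]
  have hcompl : φ ⁻¹' Set.Iic s = {x | s < φ x}ᶜ := by
    ext x
    simp
  have hmeas : MeasurableSet {x | s < φ x} := measurableSet_lt measurable_const hφm
  refine ENNReal.ofReal_le_of_le_toReal ?_
  change 1 - η ≤ m.real (φ ⁻¹' Set.Iic s)
  rw [hcompl, probReal_compl_eq_one_sub hmeas]
  linarith

end Bound

end BoundaryConcentration

theorem theorem1p1
    (d : ℕ → ℕ) [∀ n, NeZero (d n)] (hd : ∀ n, 2 ≤ d n)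
    (M : ℕ → Type*) [∀ n, MetricSpace (M n)]
    [∀ n, ChartedSpace (EuclideanHalfSpace (d n)) (M n)]
    [∀ n, IsManifold (𝓡∂ (d n)) ∞ (M n)]
    [∀ n, RiemannianBundle (fun x : M n => TangentSpace (𝓡∂ (d n)) x)]
    [∀ n, IsContMDiffRiemannianBundle (𝓡∂ (d n)) ∞ (EuclideanSpace ℝ (Fin (d n)))
      (fun x : M n => TangentSpace (𝓡∂ (d n)) x)]
    [∀ n, IsRiemannianManifold (𝓡∂ (d n)) (M n)]
    [∀ n, CompactSpace (M n)] [∀ n, ConnectedSpace (M n)]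
    [∀ n, MeasurableSpace (M n)] [∀ n, BorelSpace (M n)]
    (f : ∀ n, M n → ℝ) (hf : ∀ n, ContMDiff (𝓡∂ (d n)) 𝓘(ℝ, ℝ) ∞ (f n))
    (hprob : ∀ n, IsProbabilityMeasure (weightedMeasure (d n) (f n)))
    (hν : Tendsto (fun n => firstDirichletEigenvalue (d n) (f n)) atTop atTop) :
    IsBoundaryConcentrationFamily (fun n => (𝓡∂ (d n)).boundary (M n))
      (fun n => weightedMeasure (d n) (f n)) := by
  intro η hη
  rw [ENNReal.tendsto_nhds_zero]
  intro ε hε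
  obtain ⟨s, hs, hsε⟩ := ENNReal.lt_iff_exists_nnreal_btwn.1 hε
  have hs0 : 0 < s := ENNReal.coe_pos.1 hs
  filter_upwards [hν.eventually_ge_atTop (16 / ((s : ℝ) ^ 2 * η))] with n hn
  exact (obsInRad_le_of_le_firstDirichletEigenvalue (hf n).continuous hs0 hη hn).trans hsε.le
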